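/- Let $H$ be a separable complex Hilbert space, let $A:D(A)\subset H\to H$ be a strictly positive selfadjoint operator (that is, $\langle Au,u\rangle\ge c\|u\|^2$ on $D(A)$ for some $c>0$), so that $\sigma(A)\subset(0,\infty)$, and let $f:\sigma(A)\to[0,\infty)$ be continuous. Let $f(A)=\int_{\sigma(A)}f\,dE_A$ and $A^{1/2}=\int_{\sigma(A)}\sqrt{s}\,dE_A(s)$ be defined by the functional calculus, $E_A$ being the spectral measure of $A$. Let $H^1=D(A^{1/2})$ with norm $\|u\|_1=\|A^{1/2}u\|$, let $\mathcal H=H^1\times H$ with norm $(\|u\|_1^2+\|v\|^2)^{1/2}$, and let $\mathbb A$ be the operator on $\mathcal H$ given by $$\mathbb A(u,v)=(v,\,-Au-f(A)v),\qquad D(\mathbb A)=\{(u,v)\in\mathcal H:\ v\in H^1,\ Au+f(A)v\in H\},$$ where $Au+f(A)v=h\in H$ means that $\langle Aw,u\rangle+\langle f(A)w,v\rangle=\langle w,h\rangle$ for all $w\in D(A)\cap D(f(A))$. For $s\in\sigma(A)$ let $$\xi_s^\pm=\begin{cases}-\frac{f(s)}2\pm\frac{\sqrt{f(s)^2-4s}}2&\text{if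 } f(s)\ge 2\sqrt s,\\[1mm] -\frac{f(s)}2\pm i\,\frac{\sqrt{4s-f(s)^2}}2&\text{if } f(s)<2\sqrt s,\end{cases}$$ be the two roots of $\xi^2+f(s)\xi+s=0$, and let $$\Lambda=\Big\{\ell>0:\ \exists\, s_n\in\sigma(A)\text{ with } s_n\to\infty\text{ and }\lim_{n\to\infty}\frac{f(s_n)}{s_n}=\ell\Big\}$$ (possibly empty). Then $$\sigma(\mathbb A)\setminus\{0\}=\bigcup_{s\in\sigma(A)}\{\xi_s^+,\xi_s^-\}\ \cup\ \bigcup_{\ell\in\Lambda}\Big\{-\frac1\ell\Big\}.$$ -/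

import Mathlib

open Filter Topology MeasureTheory

noncomputable section

namespace DampedEvolution

/-! ### Spectrum of an unbounded operator -/

section Spectrum

variable {E : Type*} [SeminormedAddCommGroup E] [NormedSpace ℂ E]

/-- The resolvent set of an unbounded operator `T` on `E`: those `ξ` for which `ξ - T`, as a map from
the domain of `T` to `E`, is bijective with bounded (everywhere defined) inverse `R`. -/
def resolventSet (T : E →ₗ.[ℂ] E) : Set ℂ :=
  {ξ | ∃ R : E →L[ℂ] E,
      (∀ y : E, ∃ h : R y ∈ T.domain, ξ • R y - T ⟨R y, h⟩ = y) ∧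
      (∀ x : T.domain, R (ξ • (x : E) - T x) = x)}

/-- The spectrum of an unbounded operator. -/
def spectrum (T : E →ₗ.[ℂ] E) : Set ℂ := (resolventSet T)ᶜ

/-- The real points of the spectrum. For a selfadjoint operator this is the whole spectrum, seen as a
subset of `ℝ`. -/
def realSpectrum (T : E →ₗ.[ℂ] E) : Set ℝ := {s | (s : ℂ) ∈ spectrum T}

end Spectrum

variable {H : Type*} [NormedAddCommGroup H] [InnerProductSpace ℂ H] [CompleteSpace H]

/-! ### Spectral measures and functional calculus -/

/-- A spectral measure on a measurable space `Ω`, with values in the selfadjoint projections of `H`.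
The values of `proj` on non-measurable sets are irrelevant. (Mathlib's `inner ℂ v u` is linear in the
second variable `u`.) -/
structure SpectralMeasure (Ω : Type*) [MeasurableSpace Ω] (H : Type*) [NormedAddCommGroup H]
    [InnerProductSpace ℂ H] [CompleteSpace H] where
  /-- The projection attached to a measurable set. -/
  proj : Set Ω → H →L[ℂ] H
  isStarProjection : ∀ ω, MeasurableSet ω → IsStarProjection (proj ω)
  proj_empty : proj ∅ = 0
  proj_univ : proj Set.univ = 1
  proj_inter : ∀ ω₁ ω₂, MeasurableSet ω₁ → MeasurableSet ω₂ → proj (ω₁ ∩ ω₂) = proj ω₁ * proj ω₂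
  proj_union : ∀ ω₁ ω₂, MeasurableSet ω₁ → MeasurableSet ω₂ → ω₁ ∩ ω₂ = ∅ →
    proj (ω₁ ∪ ω₂) = proj ω₁ + proj ω₂
  exists_complexMeasure : ∀ u v : H, ∃ μ : ComplexMeasure Ω,
    ∀ ω, MeasurableSet ω → μ ω = inner ℂ v (proj ω u)

namespace SpectralMeasure

variable {Ω : Type*} [MeasurableSpace Ω]

/-- The complex measure `μ_{u,v}(ω) = ⟨E(ω)u, v⟩`. -/
def measure (E : SpectralMeasure Ω H) (u v : H) : ComplexMeasure Ω :=
  (E.exists_complexMeasure u v).choose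

/-- `T = ∫ φ dE`: the domain of `T` is `{u | ∫ |φ|² dμ_{u,u} < ∞}`, and `⟨T u, v⟩ = ∫ φ dμ_{u,v}` for
all `u` in this domain and all `v` in `H`. -/
def IsIntegral (E : SpectralMeasure Ω H) (φ : Ω → ℂ) (T : H →ₗ.[ℂ] H) : Prop :=
  (∀ u : H, u ∈ T.domain ↔ (E.measure u u).Integrable (fun s => ‖φ s‖ ^ 2)) ∧
  ∀ (u : T.domain) (v : H),
    inner ℂ v (T u) = (E.measure u v).integral φ (ContinuousLinearMap.mul ℝ ℂ)

/-- The operator `∫ φ dE`, characterized by `IsIntegral`. For continuous `φ` it exists and is unique. -/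
def integral (E : SpectralMeasure Ω H) (φ : Ω → ℂ) : H →ₗ.[ℂ] H :=
  Classical.epsilon fun T => E.IsIntegral φ T

end SpectralMeasure

/-- `E` is the spectral measure of `A`: it lives on `σ(A)` and `A = ∫ s dE(s)`. -/
def IsSpectralMeasureOf (A : H →ₗ.[ℂ] H) (E : SpectralMeasure (realSpectrum A) H) : Prop :=
  E.IsIntegral (fun s => ((s : ℝ) : ℂ)) A

open Classical in
/-- The operator `φ(A) = ∫ φ dE_A`, where `E_A` is the spectral measure of `A`. For selfadjoint `A` the
spectral measure exists and is unique; if `A` has none, the value is irrelevant. -/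
def functionalCalculus (A : H →ₗ.[ℂ] H) (φ : realSpectrum A → ℂ) : H →ₗ.[ℂ] H :=
  if h : ∃ E : SpectralMeasure (realSpectrum A) H, IsSpectralMeasureOf A E then
    h.choose.integral φ
  else ⊥

/-- `f(A)` for a real function `f` on the spectrum. -/
def realCalculus (A : H →ₗ.[ℂ] H) (f : realSpectrum A → ℝ) : H →ₗ.[ℂ] H :=
  functionalCalculus A fun s => (f s : ℂ)

/-- The square root `A^{1/2}`. -/
def sqrtOp (A : H →ₗ.[ℂ] H) : H →ₗ.[ℂ] H :=
  realCalculus A fun s => Real.sqrt s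

/-- `A` is strictly positive. -/
def IsStrictlyPositive (A : H →ₗ.[ℂ] H) : Prop :=
  ∃ c : ℝ, 0 < c ∧ ∀ u : A.domain, c * ‖(u : H)‖ ^ 2 ≤ (inner ℂ (u : H) (A u)).re

/-! ### The phase space -/

/-- The space `H¹`, the domain of `A^{1/2}`, to be normed by `‖u‖₁ = ‖A^{1/2} u‖`. -/
def HOne (A : H →ₗ.[ℂ] H) : Type _ := (sqrtOp A).domain

/-- The norm `‖u‖₁ = ‖A^{1/2} u‖`. -/
instance (A : H →ₗ.[ℂ] H) : SeminormedAddCommGroup (HOne A) :=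
  SeminormedAddCommGroup.induced (sqrtOp A).domain H (sqrtOp A).toFun

instance (A : H →ₗ.[ℂ] H) : Module ℂ (HOne A) :=
  inferInstanceAs (Module ℂ (sqrtOp A).domain)

instance (A : H →ₗ.[ℂ] H) : NormedSpace ℂ (HOne A) where
  norm_smul_le a u := by
    change ‖(sqrtOp A).toFun (a • (show (sqrtOp A).domain from u))‖ ≤
      ‖a‖ * ‖(sqrtOp A).toFun (show (sqrtOp A).domain from u)‖
    rw [map_smul, norm_smul]

/-- The inclusion of `H¹` in `H`. -/
def HOne.incl (A : H →ₗ.[ℂ] H) : HOne A →ₗ[ℂ] H := (sqrtOp A).domain.subtype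

/-- The phase space `H¹ × H` with norm `(‖u‖₁² + ‖v‖²)^{1/2}`. -/
abbrev PhaseSpace (A : H →ₗ.[ℂ] H) : Type _ := WithLp 2 (HOne A × H)

/-! ### The generator -/

/-- `A u + f(A) v = h` with `h ∈ H`, where `A u` and `f(A) v` are read in the dual spaces of `D(A)` and
`D(f(A))`: `⟨A w, u⟩ + ⟨f(A) w, v⟩ = ⟨w, h⟩` for all `w` in `D(A) ∩ D(f(A))`. -/
def IsWeakSum (A : H →ₗ.[ℂ] H) (f : realSpectrum A → ℝ) (u v h : H) : Prop :=
  ∀ (w : H) (hA : w ∈ A.domain) (hf : w ∈ (realCalculus A f).domain),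
    inner ℂ u (A ⟨w, hA⟩) + inner ℂ v (realCalculus A f ⟨w, hf⟩) = inner ℂ h w

/-- The graph of the generator: the pairs `((u, v), (u', v'))` in the square of the phase space with
`u' = v` (so that `v ∈ H¹`) and `A u + f(A) v = -v'` in `H`. -/
def generatorGraph (A : H →ₗ.[ℂ] H) (f : realSpectrum A → ℝ) :
    Submodule ℂ (PhaseSpace A × PhaseSpace A) where
  carrier := {p | HOne.incl A p.2.fst = p.1.snd ∧
    IsWeakSum A f (HOne.incl A p.1.fst) p.1.snd (-p.2.snd)}
  zero_mem' := by
    refine ⟨by simp, fun w _ _ => by simp⟩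
  add_mem' := by
    rintro p q ⟨hp1, hp2⟩ ⟨hq1, hq2⟩
    refine ⟨by simp [hp1, hq1], fun w hA hf => ?_⟩
    have h1 := hp2 w hA hf
    have h2 := hq2 w hA hf
    simp only [Prod.fst_add, Prod.snd_add, WithLp.add_fst, WithLp.add_snd, map_add, neg_add,
      inner_add_left]
    rw [← h1, ← h2]
    ring
  smul_mem' := by
    rintro c p ⟨hp1, hp2⟩
    refine ⟨by simp [hp1], fun w hA hf => ?_⟩
    have h1 := hp2 w hA hf
    simp only [Prod.smul_fst, Prod.smul_snd, WithLp.smul_fst, WithLp.smul_snd, map_smul, ← smul_neg,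
      inner_smul_left]
    rw [← h1]
    ring

/-- The operator `𝔸 (u, v) = (v, -A u - f(A) v)` on `H¹ × H`, with domain
`{(u, v) | v ∈ H¹, A u + f(A) v ∈ H}`. -/
def generator (A : H →ₗ.[ℂ] H) (f : realSpectrum A → ℝ) : PhaseSpace A →ₗ.[ℂ] PhaseSpace A :=
  (generatorGraph A f).toLinearPMap

/-! ### The sets in the description of the spectrum -/

/-- The root `ξ_s⁺` of `ξ² + a ξ + s = 0`, for `a = f(s)`. -/
def xiPlus (a s : ℝ) : ℂ :=
  if 2 * √s ≤ a then -(a : ℂ) / 2 + (√(a ^ 2 - 4 * s) : ℝ) / 2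
  else -(a : ℂ) / 2 + Complex.I * ((√(4 * s - a ^ 2) : ℝ) / 2)

/-- The root `ξ_s⁻` of `ξ² + a ξ + s = 0`, for `a = f(s)`. -/
def xiMinus (a s : ℝ) : ℂ :=
  if 2 * √s ≤ a then -(a : ℂ) / 2 - (√(a ^ 2 - 4 * s) : ℝ) / 2
  else -(a : ℂ) / 2 - Complex.I * ((√(4 * s - a ^ 2) : ℝ) / 2)

/-- The set `Λ` of positive limits of `f(s_n)/s_n` along sequences in the spectrum with `s_n → ∞`. -/
def limitSet (A : H →ₗ.[ℂ] H) (f : realSpectrum A → ℝ) : Set ℝ :=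
  {l | 0 < l ∧ ∃ s : ℕ → realSpectrum A, Tendsto (fun n => (s n : ℝ)) atTop atTop ∧
    Tendsto (fun n => f (s n) / (s n : ℝ)) atTop (𝓝 l)}

end DampedEvolution

end

open Filter Topology MeasureTheory

noncomputable section

namespace DampedEvolution

section

/-! ### Integrals with respect to complex measures -/

section ComplexMeasure

/-! ### Densities, scalar multiples and conjugates of complex measures -/

variable {Ω : Type*} [MeasurableSpace Ω]

/-! Identify `H¹` with `H` through the isometry `A^{1/2}`. In the spectral representation of `A` the
generator becomes multiplication by the matrix `M(s) = [[0, √s], [-√s, -f(s)]]`, and with `p(s) = ξ²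
+ ξ f(s) + s` one has `(ξ - M(s))⁻¹ = p(s)⁻¹ [[ξ + f(s), √s], [-√s, ξ]]`. Since `s = p - ξ (ξ + f)`
and `s ≥ c > 0` on `σ(A)`, a bound on `(ξ + f)/p` alone bounds `s/p`, hence all four entries. So `ξ`
is in the resolvent set iff `ε |ξ + f| ≤ |p|` on `σ(A)` for some `ε > 0`.

Sufficiency (`mem_resolventSet_generator`) writes down the resolvent with these multipliers. For
necessity (`exists_le_of_mem_resolventSet_generator`), the spectral projection of every
neighbourhood of a point of `σ(A)` is nonzero; where the inequality fails, a vector in the range of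
such a projection gives an approximate eigenvector of the generator.

It remains to read off when the inequality fails for every `ε`
(`root_or_limit_of_forall_exists_lt`). Take `s_n` with `|p(s_n)| < |ξ + f(s_n)|/(n+1)`. If a
subsequence is bounded, a limit point is a zero of `p`. Otherwise `s_n → ∞`, and division by `s_n`
gives `ξ f(s_n)/s_n → -1`, so `-1/ξ` belongs to `Λ`. The point `ξ = 0` is special: there the
criterion asks whether `f(s)/s` is bounded, which the right-hand side does not record.

All this needs a multiplicative functional calculus for the spectral measures of the statement
(`SpectralMeasure.Maps.comp_iff`) and the existence of the spectral measure of `A`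
(`exists_isSpectralMeasureOf`), obtained from the continuous functional calculus of the bounded
inverse `A⁻¹`. -/

theorem variation_withDensity_mul {μ : ComplexMeasure Ω} {φ : Ω → ℂ}
    (hφ : VectorMeasure.Integrable μ φ) :
    (VectorMeasure.withDensity μ φ (ContinuousLinearMap.mul ℝ ℂ)).variation =
      (VectorMeasure.variation μ).withDensity fun s => ‖φ s‖ₑ := by
  rw [VectorMeasure.variation_withDensity hφ (by simp),
    VectorMeasure.variation_transpose_eq μ (ContinuousLinearMap.mul ℝ ℂ) (by simp)]

/-- The density gives integrability of `|φ| ψ`; multiply by the phase `φ/|φ|`, which has modulus at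
most `1` (and is `0/0 = 0` where `φ` vanishes). -/
theorem integrable_mul_of_integrable_withDensity {ν : Measure Ω} {φ ψ : Ω → ℂ}
    (hφ : Measurable φ) (hψ : Integrable ψ (ν.withDensity fun s => ‖φ s‖ₑ)) :
    Integrable (fun s => ψ s * φ s) ν := by
  have h1 : Integrable (fun s => ‖φ s‖₊ • ψ s) ν :=
    (integrable_withDensity_iff_integrable_smul₀ hφ.nnnorm.aemeasurable).1 hψ
  have h2 : Integrable (fun s => (φ s / ‖φ s‖) * (‖φ s‖₊ • ψ s)) ν := by
    refine h1.bdd_mul (c := 1)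
      (hφ.div (Complex.measurable_ofReal.comp hφ.norm)).aestronglyMeasurable (Eventually.of_forall fun s => ?_)
    rw [norm_div, Complex.norm_real, norm_norm]
    exact div_self_le_one _
  refine h2.congr (Eventually.of_forall fun s => ?_)
  change φ s / ‖φ s‖ * (((‖φ s‖ : ℝ) : ℂ) * ψ s) = ψ s * φ s
  rcases eq_or_ne (φ s) 0 with h | h
  · simp [h]
  · have : ((‖φ s‖ : ℝ) : ℂ) ≠ 0 := by simpa using h
    field_simp

theorem integral_const_mul_complexMeasure (c : ℂ) {μ : ComplexMeasure Ω} {φ : Ω → ℂ}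
    (hφ : VectorMeasure.Integrable μ φ) :
    VectorMeasure.integral μ (fun s => c * φ s) (ContinuousLinearMap.mul ℝ ℂ) =
      c * VectorMeasure.integral μ φ (ContinuousLinearMap.mul ℝ ℂ) := by
  have hC := VectorMeasure.continuousLinearMap_apply_integral
    (B := ContinuousLinearMap.mul ℝ ℂ) (C := ContinuousLinearMap.mul ℝ ℂ c) hφ
  have hC' := VectorMeasure.integral_continuousLinearMap_comp
    (B := ContinuousLinearMap.mul ℝ ℂ) (C := ContinuousLinearMap.mul ℝ ℂ c) hφ
  have hB : (ContinuousLinearMap.compL ℝ ℂ ℂ ℂ (ContinuousLinearMap.mul ℝ ℂ c)) ∘L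
      (ContinuousLinearMap.mul ℝ ℂ) =
      (ContinuousLinearMap.mul ℝ ℂ) ∘L (ContinuousLinearMap.mul ℝ ℂ c) := by
    refine ContinuousLinearMap.ext fun x => ContinuousLinearMap.ext fun y => ?_
    simp [mul_assoc]
  rw [hB, ← hC'] at hC
  exact hC.symm

/-- Both sides are additive and `L¹(|φ| |μ|)`-continuous in `ψ`, so it suffices to treat constants
times indicators, where the identity is the definition of the density. -/
theorem integral_withDensity_mul {μ : ComplexMeasure Ω} {φ ψ : Ω → ℂ} (hφm : Measurable φ)
    (hφ : VectorMeasure.Integrable μ φ)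
    (hψ : Integrable ψ ((VectorMeasure.variation μ).withDensity fun s => ‖φ s‖ₑ)) :
    VectorMeasure.integral (VectorMeasure.withDensity μ φ (ContinuousLinearMap.mul ℝ ℂ)) ψ
        (ContinuousLinearMap.mul ℝ ℂ) =
      VectorMeasure.integral μ (fun s => ψ s * φ s) (ContinuousLinearMap.mul ℝ ℂ) := by
  have hvar := variation_withDensity_mul hφ
  have hint : ∀ {χ : Ω → ℂ}, Integrable χ ((VectorMeasure.variation μ).withDensity fun s => ‖φ s‖ₑ) →
      VectorMeasure.Integrable μ (fun s => χ s * φ s) :=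
    integrable_mul_of_integrable_withDensity hφm
  rw [← hvar] at hψ
  simp_rw [← hvar] at hint
  apply hψ.induction (P := fun ψ =>
    VectorMeasure.integral (VectorMeasure.withDensity μ φ (ContinuousLinearMap.mul ℝ ℂ)) ψ
        (ContinuousLinearMap.mul ℝ ℂ) =
      VectorMeasure.integral μ (fun s => ψ s * φ s) (ContinuousLinearMap.mul ℝ ℂ))
  · intro a s hs hfin
    have : IsFiniteMeasure ((VectorMeasure.withDensity μ φ
      (ContinuousLinearMap.mul ℝ ℂ)).variation.restrict s) := ⟨by simpa using hfin⟩
    rw [VectorMeasure.integral_indicator_const _ hs, VectorMeasure.withDensity_apply hφ,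
      ← VectorMeasure.integral_indicator hs]
    rw [ContinuousLinearMap.mul_apply', ← integral_const_mul_complexMeasure a (hφ.indicator hs)]
    congr 1
    ext x
    by_cases hx : x ∈ s <;> simp [hx]
  · intro χ₁ χ₂ _ h₁ h₂ e₁ e₂
    rw [VectorMeasure.integral_add h₁ h₂, e₁, e₂, ← VectorMeasure.integral_add (hint h₁) (hint h₂)]
    congr 1
    ext x
    simp [add_mul]
  · apply isClosed_eq VectorMeasure.continuous_integral
    -- The distance of `χ₁ φ` and `χ₂ φ` in `L¹(|μ|)` is that of `χ₁` and `χ₂` in `L¹(|φ| |μ|)`.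
    refine LipschitzWith.continuous (K := ‖ContinuousLinearMap.mul ℝ ℂ‖₊) fun χ₁ χ₂ => ?_
    refine (VectorMeasure.edist_integral_le_lintegral_edist (hint (L1.integrable_coeFn χ₁))
      (hint (L1.integrable_coeFn χ₂))).trans ?_
    gcongr
    · exact le_of_eq (enorm_eq_nnnorm _)
    rw [L1.edist_def]
    have hgen : ∀ (χ : Ω → ENNReal), AEMeasurable χ
        (VectorMeasure.withDensity μ φ (ContinuousLinearMap.mul ℝ ℂ)).variation →
        ∫⁻ s, χ s ∂(VectorMeasure.withDensity μ φ (ContinuousLinearMap.mul ℝ ℂ)).variation =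
          ∫⁻ s, ‖φ s‖ₑ * χ s ∂(VectorMeasure.variation μ) := by
      intro χ hχ
      rw [hvar] at hχ ⊢
      exact lintegral_withDensity_eq_lintegral_mul₀' hφm.enorm.aemeasurable hχ
    rw [hgen]
    · refine le_of_eq (lintegral_congr fun s => ?_)
      rw [edist_eq_enorm_sub, ← sub_mul, enorm_mul, mul_comm]
      rw [edist_eq_enorm_sub]
    · exact ((Lp.aestronglyMeasurable χ₁).edist (Lp.aestronglyMeasurable χ₂))
  · intro χ₁ χ₂ h h₁ e
    rw [← VectorMeasure.integral_congr_ae h, e]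
    refine VectorMeasure.integral_congr_ae ?_
    rw [hvar] at h
    have := (ae_withDensity_iff hφm.enorm).1 h
    filter_upwards [this] with x hx
    rcases eq_or_ne (φ x) 0 with h0 | h0
    · simp [h0]
    · rw [hx (by simpa using h0)]

theorem integral_smul_complexMeasure (c : ℂ) {μ : ComplexMeasure Ω}
    [IsFiniteMeasure (VectorMeasure.variation μ)] {φ : Ω → ℂ}
    (hφ : VectorMeasure.Integrable μ φ) :
    VectorMeasure.integral (c • μ) φ (ContinuousLinearMap.mul ℝ ℂ) =
      c * VectorMeasure.integral μ φ (ContinuousLinearMap.mul ℝ ℂ) := by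
  have hc : VectorMeasure.Integrable μ (fun _ : Ω => c) := integrable_const c
  -- A scalar multiple is a constant density, so the previous change of density applies.
  have hμ : c • μ = VectorMeasure.withDensity μ (fun _ => c) (ContinuousLinearMap.mul ℝ ℂ) := by
    ext1 s hs
    rw [VectorMeasure.withDensity_apply hc, VectorMeasure.setIntegral_const]
    rfl
  rw [hμ, integral_withDensity_mul measurable_const hc]
  · simp_rw [← integral_const_mul_complexMeasure c hφ, mul_comm]
  · rw [withDensity_const]
    exact hφ.smul_measure (by simp)

/-- A complex measure whose values are those of a finite positive measure. -/
theorem variation_eq_of_apply_eq {μ : ComplexMeasure Ω} {m : Measure Ω} [IsFiniteMeasure m]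
    (h : ∀ ω, MeasurableSet ω → μ ω = ((m ω).toReal : ℂ)) : VectorMeasure.variation μ = m := by
  have he : ∀ ω, MeasurableSet ω → ‖μ ω‖ₑ = m ω := by
    intro ω hω
    rw [h ω hω, ← ofReal_norm, Complex.norm_real, Real.norm_of_nonneg
      ENNReal.toReal_nonneg, ENNReal.ofReal_toReal (measure_ne_top m ω)]
  refine le_antisymm (VectorMeasure.variation_le_of_forall_enorm_le fun ω hω => (he ω hω).le) ?_
  refine Measure.le_iff.2 fun ω hω => ?_
  rw [← he ω hω]
  exact VectorMeasure.enorm_measure_le_variation _ _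

theorem integral_eq_of_apply_eq {μ : ComplexMeasure Ω} {m : Measure Ω} [IsFiniteMeasure m]
    (h : ∀ ω, MeasurableSet ω → μ ω = ((m ω).toReal : ℂ)) (φ : Ω → ℂ) :
    VectorMeasure.integral μ φ (ContinuousLinearMap.mul ℝ ℂ) = ∫ s, φ s ∂m := by
  have hv := variation_eq_of_apply_eq h
  rw [VectorMeasure.integral_eq_setToFun, MeasureTheory.integral_eq_setToFun]
  simp only [hv]
  apply setToFun_congr_left' _ _ fun s hs _ => ?_
  ext
  simp [VectorMeasure.transpose, h s hs, weightedSMul, Measure.real]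

/-- Conjugation does not change the variation. -/
theorem variation_eq_of_apply_eq_conj {μ ν : ComplexMeasure Ω}
    (h : ∀ ω, MeasurableSet ω → μ ω = starRingEnd ℂ (ν ω)) :
    VectorMeasure.variation μ = VectorMeasure.variation ν := by
  have he : ∀ ω, MeasurableSet ω → ‖μ ω‖ₑ = ‖ν ω‖ₑ := by
    intro ω hω
    rw [h ω hω, RCLike.enorm_conj]
  apply le_antisymm
  · refine VectorMeasure.variation_le_of_forall_enorm_le fun ω hω => ?_
    rw [he ω hω]
    exact VectorMeasure.enorm_measure_le_variation _ _
  · refine VectorMeasure.variation_le_of_forall_enorm_le fun ω hω => ?_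
    rw [← he ω hω]
    exact VectorMeasure.enorm_measure_le_variation _ _

theorem integral_conj_of_apply_eq_conj {μ ν : ComplexMeasure Ω}
    (h : ∀ ω, MeasurableSet ω → μ ω = starRingEnd ℂ (ν ω)) {φ : Ω → ℂ}
    (hφ : VectorMeasure.Integrable ν φ) :
    VectorMeasure.integral μ (fun s => starRingEnd ℂ (φ s)) (ContinuousLinearMap.mul ℝ ℂ) =
      starRingEnd ℂ (VectorMeasure.integral ν φ (ContinuousLinearMap.mul ℝ ℂ)) := by
  have hv := variation_eq_of_apply_eq_conj h
  have hφ' : VectorMeasure.Integrable μ φ := by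
    change Integrable φ (VectorMeasure.variation μ)
    rw [hv]
    exact hφ
  have h1 := VectorMeasure.continuousLinearMap_apply_integral
    (B := ContinuousLinearMap.mul ℝ ℂ) (C := (Complex.conjCLE : ℂ →L[ℝ] ℂ)) hφ
  have h2 := VectorMeasure.integral_continuousLinearMap_comp
    (B := ContinuousLinearMap.mul ℝ ℂ) (C := (Complex.conjCLE : ℂ →L[ℝ] ℂ)) hφ'
  refine h2.trans (Eq.trans ?_ h1.symm)
  rw [VectorMeasure.integral_eq_setToFun, VectorMeasure.integral_eq_setToFun]
  simp only [hv]
  apply setToFun_congr_left' _ _ fun s hs _ => ?_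
  refine ContinuousLinearMap.ext fun x => ?_
  change starRingEnd ℂ x * μ s = starRingEnd ℂ (x * ν s)
  rw [h s hs, map_mul]

end ComplexMeasure

end

section

/-! ### Integration with respect to a spectral measure -/

namespace SpectralMeasure

variable {H : Type*} [NormedAddCommGroup H] [InnerProductSpace ℂ H] [CompleteSpace H]
variable {Ω : Type*} [MeasurableSpace Ω]

/-! ### The measures `μ_{u,v}`: sesquilinearity and bounds on the variation -/

section Basic

variable (E : SpectralMeasure Ω H) {ω : Set Ω} (u v : H)

theorem measure_apply (hω : MeasurableSet ω) : E.measure u v ω = inner ℂ v (E.proj ω u) :=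
  (E.exists_complexMeasure u v).choose_spec ω hω

theorem inner_proj_left (hω : MeasurableSet ω) :
    inner ℂ (E.proj ω v) u = inner ℂ v (E.proj ω u) := by
  have h := (E.isStarProjection ω hω).isSelfAdjoint
  rw [ContinuousLinearMap.isSelfAdjoint_iff'] at h
  conv_lhs => rw [← h]
  rw [ContinuousLinearMap.adjoint_inner_left]

theorem proj_proj (hω : MeasurableSet ω) : E.proj ω (E.proj ω u) = E.proj ω u := by
  have h := E.proj_inter ω ω hω hω
  rw [Set.inter_self] at h
  exact (DFunLike.congr_fun h u).symm

theorem inner_proj_self (hω : MeasurableSet ω) :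
    inner ℂ u (E.proj ω u) = ((‖E.proj ω u‖ ^ 2 : ℝ) : ℂ) := by
  rw [← E.proj_proj u hω, ← E.inner_proj_left _ _ hω, E.proj_proj u hω, inner_self_eq_norm_sq_to_K]
  simp

/-- The positive measure `ω ↦ ‖E(ω)u‖²`. -/
def diag : Measure Ω := (E.measure u u).variation

/-- `μ_{u,u}` is real and nonnegative on measurable sets, so its real part is a positive measure.
Comparison with it evaluates the variation in `diag_apply`. -/
theorem exists_diag : ∃ m : Measure Ω, IsFiniteMeasure m ∧
    ∀ ω, MeasurableSet ω → m ω = ENNReal.ofReal (‖E.proj ω u‖ ^ 2) := by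
  have hr : ∀ ω, MeasurableSet ω → ComplexMeasure.re (E.measure u u) ω = ‖E.proj ω u‖ ^ 2 := by
    intro ω hω
    have : ComplexMeasure.re (E.measure u u) ω = (E.measure u u ω).re := rfl
    rw [this, E.measure_apply u u hω, E.inner_proj_self u hω, Complex.ofReal_re]
  have h0 : VectorMeasure.restrict 0 Set.univ ≤
      VectorMeasure.restrict (ComplexMeasure.re (E.measure u u)) Set.univ := by
    refine VectorMeasure.restrict_le_restrict_of_subset_le _ _ fun ω hω _ => ?_
    rw [hr ω hω]
    simp
  refine ⟨SignedMeasure.toMeasureOfZeroLE _ Set.univ MeasurableSet.univ h0, inferInstance,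
    fun ω hω => ?_⟩
  rw [SignedMeasure.toMeasureOfZeroLE_apply _ h0 MeasurableSet.univ hω]
  rw [← ENNReal.ofReal_coe_nnreal]
  congr 1
  rw [← hr ω hω]
  simp

theorem measure_self_apply (hω : MeasurableSet ω) {m : Measure Ω}
    (hm : m ω = ENNReal.ofReal (‖E.proj ω u‖ ^ 2)) :
    E.measure u u ω = ((m ω).toReal : ℂ) := by
  rw [E.measure_apply u u hω, E.inner_proj_self u hω, hm, ENNReal.toReal_ofReal (by positivity)]

theorem diag_apply (hω : MeasurableSet ω) :
    E.diag u ω = ENNReal.ofReal (‖E.proj ω u‖ ^ 2) := by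
  obtain ⟨m, _, hm⟩ := E.exists_diag u
  have : E.diag u = m := variation_eq_of_apply_eq fun ω hω => E.measure_self_apply u hω (hm ω hω)
  rw [this, hm ω hω]

theorem diag_univ : E.diag u Set.univ = ENNReal.ofReal (‖u‖ ^ 2) := by
  rw [E.diag_apply u MeasurableSet.univ, E.proj_univ]
  rfl

instance : IsFiniteMeasure (E.diag u) := ⟨by rw [E.diag_univ]; exact ENNReal.ofReal_lt_top⟩

theorem integral_measure_self (φ : Ω → ℂ) :
    (E.measure u u).integral φ (ContinuousLinearMap.mul ℝ ℂ) = ∫ s, φ s ∂(E.diag u) :=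
  integral_eq_of_apply_eq (fun _ hω => E.measure_self_apply u hω (E.diag_apply u hω)) φ

variable {u v} in
theorem measure_add_left (u' : H) : E.measure (u + u') v = E.measure u v + E.measure u' v := by
  ext1 ω hω
  rw [add_apply]
  simp only [E.measure_apply _ _ hω, map_add, inner_add_right]

theorem measure_add_right (v' : H) : E.measure u (v + v') = E.measure u v + E.measure u v' := by
  ext1 ω hω
  rw [add_apply]
  simp only [E.measure_apply _ _ hω, inner_add_left]

theorem measure_smul_left (c : ℂ) : E.measure (c • u) v = c • E.measure u v := by
  ext1 ω hω
  rw [smul_apply]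
  simp only [E.measure_apply _ _ hω, map_smul, inner_smul_right, smul_eq_mul]

theorem measure_smul_right (c : ℂ) :
    E.measure u (c • v) = starRingEnd ℂ c • E.measure u v := by
  ext1 ω hω
  rw [smul_apply]
  simp only [E.measure_apply _ _ hω, inner_smul_left, smul_eq_mul]

theorem measure_proj_right (hω : MeasurableSet ω) :
    E.measure u (E.proj ω v) = (E.measure u v).restrict ω := by
  ext1 τ hτ
  rw [VectorMeasure.restrict_apply _ hω hτ, E.measure_apply _ _ hτ,
    E.measure_apply _ _ (hτ.inter hω), Set.inter_comm, E.proj_inter _ _ hω hτ,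
    E.inner_proj_left _ _ hω]
  rfl

theorem measure_swap (hω : MeasurableSet ω) :
    E.measure u v ω = starRingEnd ℂ (E.measure v u ω) := by
  rw [E.measure_apply _ _ hω, E.measure_apply _ _ hω, inner_conj_symm, E.inner_proj_left _ _ hω]

theorem variation_measure_swap : (E.measure u v).variation = (E.measure v u).variation :=
  variation_eq_of_apply_eq_conj fun _ hω => E.measure_swap u v hω

/-- `⟨E(ω)u, v⟩ = ⟨E(ω)u, E(ω)v⟩`, then Cauchy–Schwarz in `H` and `xy ≤ x² + y²`. -/
theorem variation_measure_le : (E.measure u v).variation ≤ E.diag u + E.diag v := by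
  refine VectorMeasure.variation_le_of_forall_enorm_le fun ω hω => ?_
  rw [Measure.add_apply, E.diag_apply u hω, E.diag_apply v hω,
    ← ENNReal.ofReal_add (by positivity) (by positivity), ← ofReal_norm, E.measure_apply _ _ hω]
  refine ENNReal.ofReal_le_ofReal ?_
  rw [← E.proj_proj u hω, ← E.inner_proj_left _ _ hω]
  refine (norm_inner_le_norm _ _).trans ?_
  rw [E.proj_proj u hω]
  nlinarith [sq_nonneg (‖E.proj ω u‖ - ‖E.proj ω v‖), sq_nonneg (‖E.proj ω u‖),
    sq_nonneg (‖E.proj ω v‖)]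

instance : IsFiniteMeasure (E.measure u v).variation :=
  isFiniteMeasure_of_le _ (E.variation_measure_le u v)

theorem diag_smul (c : ℂ) : E.diag (c • u) = ‖c‖ₑ ^ 2 • E.diag u := by
  ext ω hω
  rw [Measure.smul_apply, E.diag_apply _ hω, E.diag_apply _ hω, map_smul, norm_smul, mul_pow,
    ENNReal.ofReal_mul (by positivity), smul_eq_mul, ENNReal.ofReal_pow (norm_nonneg _),
    ofReal_norm]

theorem diag_add_le : E.diag (u + v) ≤ (2 : ENNReal) • (E.diag u + E.diag v) := by
  refine Measure.le_iff.2 fun ω hω => ?_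
  rw [Measure.smul_apply, Measure.add_apply, E.diag_apply _ hω, E.diag_apply _ hω,
    E.diag_apply _ hω, ← ENNReal.ofReal_add (by positivity) (by positivity), smul_eq_mul,
    ← ENNReal.ofReal_ofNat 2, ← ENNReal.ofReal_mul (by norm_num), map_add]
  refine ENNReal.ofReal_le_ofReal ?_
  have h := norm_add_le (E.proj ω u) (E.proj ω v)
  nlinarith [sq_nonneg (‖E.proj ω u‖ - ‖E.proj ω v‖), norm_nonneg (E.proj ω u + E.proj ω v)]

/-- The preceding bound for the rescaled vector `(n + 1) u`; the free factor `n + 1` is matched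
below to the size of the integrand. -/
theorem mul_variation_measure_le (n : ℕ) (ω : Set Ω) :
    ((n : ENNReal) + 1) * (E.measure u v).variation ω ≤
      ((n : ENNReal) + 1) ^ 2 * E.diag u ω + E.diag v ω := by
  have h := E.variation_measure_le (((n : ℂ) + 1) • u) v ω
  have hn : ‖(n : ℂ) + 1‖ₑ = (n : ENNReal) + 1 := by
    rw [← ofReal_norm]
    have : (n : ℂ) + 1 = ((n + 1 : ℕ) : ℂ) := by push_cast; rfl
    rw [this, Complex.norm_natCast, ENNReal.ofReal_natCast]
    push_cast
    rfl
  rw [E.measure_smul_left, VectorMeasure.variation_smul, E.diag_smul] at h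
  have hn' : ((‖(n : ℂ) + 1‖₊ : NNReal) : ENNReal) = (n : ENNReal) + 1 := hn
  simpa [hn, hn'] using h

/-- A substitute for the Cauchy–Schwarz inequality of `|μ_{u,v}|`: slice `Ω` by `⌊|φ|⌋ = n`. On a
slice `|φ| ≤ n + 1 ≤ |φ| + 1`, so the scaled bound with this `n` can be summed. -/
theorem lintegral_variation_measure_le {φ : Ω → ℂ} (hφ : Measurable φ) :
    ∫⁻ s, ‖φ s‖ₑ ∂(E.measure u v).variation ≤
      ∫⁻ s, (‖φ s‖ₑ + 1) ^ 2 ∂(E.diag u) + E.diag v Set.univ := by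
  let τ : ℕ → Set Ω := fun n => {s | ⌊‖φ s‖⌋₊ = n}
  have hτ : ∀ n, MeasurableSet (τ n) := fun n =>
    (Nat.measurable_floor.comp hφ.norm) (measurableSet_singleton n)
  have hd : Pairwise (Function.onFun Disjoint τ) := by
    intro i j hij
    refine Set.disjoint_left.2 fun s hs hs' => hij ?_
    exact hs.symm.trans hs'
  have hU : ⋃ n, τ n = Set.univ := Set.eq_univ_of_forall fun s => Set.mem_iUnion.2 ⟨_, rfl⟩
  have hlow : ∀ n, ∀ s ∈ τ n, ((n : ENNReal) + 1) ≤ ‖φ s‖ₑ + 1 := by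
    intro n s hs
    gcongr
    rw [← ofReal_norm, ← ENNReal.ofReal_natCast]
    refine ENNReal.ofReal_le_ofReal ?_
    rw [← show ⌊‖φ s‖⌋₊ = n from hs]
    exact Nat.floor_le (norm_nonneg _)
  have hup : ∀ n, ∀ s ∈ τ n, ‖φ s‖ₑ ≤ (n : ENNReal) + 1 := by
    intro n s hs
    have : (n : ENNReal) + 1 = ENNReal.ofReal ((n : ℝ) + 1) := by
      rw [ENNReal.ofReal_add (by positivity) (by norm_num)]
      simp
    rw [← ofReal_norm, this]
    refine ENNReal.ofReal_le_ofReal ?_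
    rw [← show ⌊‖φ s‖⌋₊ = n from hs]
    exact (Nat.lt_floor_add_one _).le
  rw [← setLIntegral_univ, ← setLIntegral_univ (fun s => (‖φ s‖ₑ + 1) ^ 2), ← hU,
    lintegral_iUnion hτ hd, lintegral_iUnion hτ hd, measure_iUnion hd hτ, ← ENNReal.tsum_add]
  refine ENNReal.tsum_le_tsum fun n => ?_
  calc ∫⁻ s in τ n, ‖φ s‖ₑ ∂(E.measure u v).variation
      ≤ ∫⁻ _ in τ n, ((n : ENNReal) + 1) ∂(E.measure u v).variation :=
        setLIntegral_mono' (hτ n) (hup n)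
    _ = ((n : ENNReal) + 1) * (E.measure u v).variation (τ n) := by simp
    _ ≤ ((n : ENNReal) + 1) ^ 2 * E.diag u (τ n) + E.diag v (τ n) :=
        E.mul_variation_measure_le u v n (τ n)
    _ = ∫⁻ _ in τ n, ((n : ENNReal) + 1) ^ 2 ∂(E.diag u) + E.diag v (τ n) := by simp
    _ ≤ ∫⁻ s in τ n, (‖φ s‖ₑ + 1) ^ 2 ∂(E.diag u) + E.diag v (τ n) := by
        gcongr ?_ + _
        refine setLIntegral_mono' (hτ n) fun s hs => ?_
        gcongr
        have := hlow n s hs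
        simpa using this

end Basic

/-! ### The graph of `∫ φ dE` and the algebra of multipliers -/

section Maps

variable {E : SpectralMeasure Ω H} {φ ψ : Ω → ℂ} {u u' v w w' z : H}

theorem lintegral_enorm_add_one_sq_lt_top
    (h : Integrable (fun s => ‖φ s‖ ^ 2) (E.diag u)) :
    ∫⁻ s, (‖φ s‖ₑ + 1) ^ 2 ∂(E.diag u) < ⊤ := by
  have h2 : Integrable (fun s => 2 * ‖φ s‖ ^ 2 + 2) (E.diag u) :=
    (h.const_mul 2).add (integrable_const 2)
  refine lt_of_le_of_lt (lintegral_mono fun s => ?_) h2.lintegral_lt_top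
  have : ‖φ s‖ₑ + 1 = ENNReal.ofReal (‖φ s‖ + 1) := by
    rw [ENNReal.ofReal_add (norm_nonneg _) zero_le_one, ofReal_norm, ENNReal.ofReal_one]
  simp only [this]
  rw [← ENNReal.ofReal_pow (by positivity)]
  refine ENNReal.ofReal_le_ofReal ?_
  nlinarith [sq_nonneg (‖φ s‖ - 1)]

theorem integrable_measure (hφ : Measurable φ)
    (h : Integrable (fun s => ‖φ s‖ ^ 2) (E.diag u)) (v : H) :
    (E.measure u v).Integrable φ := by
  refine ⟨hφ.aestronglyMeasurable, ?_⟩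
  refine (E.lintegral_variation_measure_le u v hφ).trans_lt ?_
  exact ENNReal.add_lt_top.2 ⟨lintegral_enorm_add_one_sq_lt_top h, measure_lt_top _ _⟩

variable (E φ u w) in
/-- The pair `(u, w)` belongs to the graph of `∫ φ dE`. -/
def Maps : Prop :=
  Integrable (fun s => ‖φ s‖ ^ 2) (E.diag u) ∧
    ∀ v, inner ℂ v w = (E.measure u v).integral φ (ContinuousLinearMap.mul ℝ ℂ)

theorem Maps.unique (h : E.Maps φ u w) (h' : E.Maps φ u w') : w = w' :=
  ext_inner_left ℂ fun v => by rw [h.2, h'.2]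

/-- Riesz representation of the functional `v ↦ ∫ φ dμ_{u,v}`, conjugated because `μ_{u,v}` is
antilinear in `v`. -/
theorem exists_maps (hφ : Measurable φ) (h : Integrable (fun s => ‖φ s‖ ^ 2) (E.diag u)) :
    ∃ w, E.Maps φ u w := by
  have hi := integrable_measure hφ h
  let ℓ : H →ₗ[ℂ] ℂ :=
    { toFun := fun v => starRingEnd ℂ
        ((E.measure u v).integral φ (ContinuousLinearMap.mul ℝ ℂ))
      map_add' := fun v v' => by
        rw [E.measure_add_right, VectorMeasure.integral_add_vectorMeasure (hi v) (hi v'), map_add]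
      map_smul' := fun c v => by
        rw [E.measure_smul_right, integral_smul_complexMeasure _ (hi v), map_mul,
          Complex.conj_conj]
        rfl }
  set K : ℝ := (∫⁻ s, (‖φ s‖ₑ + 1) ^ 2 ∂(E.diag u) + 1).toReal with hK
  have hKfin : ∫⁻ s, (‖φ s‖ₑ + 1) ^ 2 ∂(E.diag u) + 1 ≠ ⊤ :=
    (ENNReal.add_lt_top.2 ⟨lintegral_enorm_add_one_sq_lt_top h, ENNReal.one_lt_top⟩).ne
  -- The integral estimate is not homogeneous in `v`, so it is used on the unit sphere only; the `+
  -- 1` in `K` is the total mass `‖v‖²` of `E.diag v`.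
  have hb : ∀ v, ‖v‖ = 1 → ‖ℓ v‖ ≤ K := by
    intro v hv
    change ‖starRingEnd ℂ _‖ ≤ K
    rw [RCLike.norm_conj, hK, ← toReal_enorm]
    refine ENNReal.toReal_mono hKfin ?_
    refine VectorMeasure.enorm_integral_le_lintegral_enorm.trans ?_
    have h1 : ‖ContinuousLinearMap.mul ℝ ℂ‖ₑ ≤ 1 := by
      rw [← ofReal_norm, ← ENNReal.ofReal_one]
      exact ENNReal.ofReal_le_ofReal (ContinuousLinearMap.opNorm_mul_le ℝ ℂ)
    refine (mul_le_of_le_one_left' h1).trans ?_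
    refine (E.lintegral_variation_measure_le u v hφ).trans ?_
    rw [E.diag_univ, hv]
    simp
  have hb' : ∀ v, ‖ℓ v‖ ≤ K * ‖v‖ := by
    intro v
    have := LinearMap.bound_of_sphere_bound (r := 1) one_pos K ℓ
      (fun v hv => hb v (by simpa using hv)) v
    simpa using this
  refine ⟨(InnerProductSpace.toDual ℂ H).symm (ℓ.mkContinuous K hb'), h, fun v => ?_⟩
  rw [← inner_conj_symm, InnerProductSpace.toDual_symm_apply]
  exact Complex.conj_conj _

theorem Maps.add_vec (hφ : Measurable φ) (h : E.Maps φ u w) (h' : E.Maps φ u' w') :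
    E.Maps φ (u + u') (w + w') := by
  refine ⟨?_, fun v => ?_⟩
  · refine Integrable.mono_measure ?_ (E.diag_add_le u u')
    exact (h.1.add_measure h'.1).smul_measure (by simp)
  · rw [inner_add_right, h.2, h'.2, E.measure_add_left, VectorMeasure.integral_add_vectorMeasure
      (integrable_measure hφ h.1 v) (integrable_measure hφ h'.1 v)]

theorem Maps.smul_vec (hφ : Measurable φ) (h : E.Maps φ u w) (c : ℂ) :
    E.Maps φ (c • u) (c • w) := by
  refine ⟨?_, fun v => ?_⟩
  · rw [E.diag_smul]
    exact h.1.smul_measure (by simp)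
  · rw [inner_smul_right, h.2, E.measure_smul_left,
      integral_smul_complexMeasure _ (integrable_measure hφ h.1 v)]

theorem Maps.add (hφ : Measurable φ) (hψ : Measurable ψ) (h : E.Maps φ u w) (h' : E.Maps ψ u z) :
    E.Maps (fun s => φ s + ψ s) u (w + z) := by
  refine ⟨?_, fun v => ?_⟩
  · refine Integrable.mono' ((h.1.add h'.1).const_mul 2) (by fun_prop)
      (Eventually.of_forall fun s => ?_)
    have := norm_add_le (φ s) (ψ s)
    rw [Real.norm_of_nonneg (by positivity)]
    simp only [Pi.add_apply]
    nlinarith [sq_nonneg (‖φ s‖ - ‖ψ s‖), norm_nonneg (φ s + ψ s)]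
  · rw [inner_add_right, h.2, h'.2, VectorMeasure.integral_fun_add
      (integrable_measure hφ h.1 v) (integrable_measure hψ h'.1 v)]

theorem Maps.const_mul (hφ : Measurable φ) (h : E.Maps φ u w) (c : ℂ) :
    E.Maps (fun s => c * φ s) u (c • w) := by
  refine ⟨?_, fun v => ?_⟩
  · simp_rw [norm_mul, mul_pow]
    exact h.1.const_mul _
  · rw [inner_smul_right, h.2,
      integral_const_mul_complexMeasure _ (integrable_measure hφ h.1 v)]

theorem Maps.sub (hφ : Measurable φ) (hψ : Measurable ψ) (h : E.Maps φ u w) (h' : E.Maps ψ u z) :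
    E.Maps (fun s => φ s - ψ s) u (w - z) := by
  have := h.add hφ (hψ.const_mul (-1)) (h'.const_mul hψ (-1))
  simpa [sub_eq_add_neg] using this

/-- Test the definition of `w` against `E(ω)v`: this restricts `μ_{u,v}` to `ω`. -/
theorem Maps.measure_eq (hφ : Measurable φ) (h : E.Maps φ u w) (v : H) :
    E.measure w v = (E.measure u v).withDensity φ (ContinuousLinearMap.mul ℝ ℂ) := by
  ext1 ω hω
  rw [E.measure_apply _ _ hω, VectorMeasure.withDensity_apply (integrable_measure hφ h.1 v),
    ← E.inner_proj_left _ _ hω, h.2, E.measure_proj_right _ _ hω]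

theorem Maps.variation_eq (hφ : Measurable φ) (h : E.Maps φ u w) (v : H) :
    (E.measure w v).variation = (E.measure u v).variation.withDensity fun s => ‖φ s‖ₑ := by
  rw [h.measure_eq hφ, variation_withDensity_mul (integrable_measure hφ h.1 v)]

/-- The density `|φ|` enters once for each argument of `μ_{w,w}`; the variation is symmetric in the
two arguments. -/
theorem Maps.diag_eq (hφ : Measurable φ) (h : E.Maps φ u w) :
    E.diag w = (E.diag u).withDensity fun s => ‖φ s‖ₑ ^ 2 := by
  rw [diag, h.variation_eq hφ, E.variation_measure_swap, h.variation_eq hφ,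
    ← withDensity_mul _ hφ.enorm hφ.enorm]
  congr 1
  ext s
  simp [sq]

/-- The functional calculus is multiplicative. -/
theorem Maps.comp_iff (hφ : Measurable φ) (hψ : Measurable ψ) (h : E.Maps φ u w) :
    E.Maps ψ w z ↔ E.Maps (fun s => ψ s * φ s) u z := by
  have hI : Integrable (fun s => ‖ψ s‖ ^ 2) (E.diag w) ↔
      Integrable (fun s => ‖ψ s * φ s‖ ^ 2) (E.diag u) := by
    rw [h.diag_eq hφ]
    have : (fun s => ‖φ s‖ₑ ^ 2) = fun s => (((‖φ s‖₊ ^ 2 : NNReal)) : ENNReal) := by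
      ext s
      rw [enorm_eq_nnnorm]
      push_cast
      rfl
    rw [this, integrable_withDensity_iff_integrable_smul₀ (by fun_prop)]
    refine integrable_congr (Eventually.of_forall fun s => ?_)
    change ‖φ s‖ ^ 2 * ‖ψ s‖ ^ 2 = ‖ψ s * φ s‖ ^ 2
    rw [norm_mul, mul_pow, mul_comm]
  have hint : ∀ (_ : Integrable (fun s => ‖ψ s‖ ^ 2) (E.diag w)) (v : H),
      (E.measure w v).integral ψ (ContinuousLinearMap.mul ℝ ℂ) =
        (E.measure u v).integral (fun s => ψ s * φ s) (ContinuousLinearMap.mul ℝ ℂ) := by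
    intro hw v
    have h1 := integrable_measure hψ hw v
    rw [h.measure_eq hφ]
    refine integral_withDensity_mul hφ (integrable_measure hφ h.1 v) ?_
    rw [← h.variation_eq hφ]
    exact h1
  constructor
  · rintro ⟨h1, h2⟩
    exact ⟨hI.1 h1, fun v => by rw [h2, hint h1]⟩
  · rintro ⟨h1, h2⟩
    exact ⟨hI.2 h1, fun v => by rw [h2, hint (hI.2 h1)]⟩

theorem Maps.enorm_sq (hφ : Measurable φ) (h : E.Maps φ u w) :
    ENNReal.ofReal (‖w‖ ^ 2) = ∫⁻ s, ‖φ s‖ₑ ^ 2 ∂(E.diag u) := by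
  rw [← E.diag_univ, h.diag_eq hφ, withDensity_apply _ MeasurableSet.univ, setLIntegral_univ]

theorem Maps.norm_le (hφ : Measurable φ) (h : E.Maps φ u w) {C : ℝ} (hC : 0 ≤ C)
    (hb : ∀ s, ‖φ s‖ ≤ C) : ‖w‖ ≤ C * ‖u‖ := by
  have h1 : ENNReal.ofReal (‖w‖ ^ 2) ≤ ENNReal.ofReal ((C * ‖u‖) ^ 2) := by
    rw [h.enorm_sq hφ, mul_pow, ENNReal.ofReal_mul (by positivity), ← E.diag_univ]
    refine (lintegral_mono (g := fun _ => ENNReal.ofReal (C ^ 2)) fun s => ?_).trans (by simp)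
    simp only
    rw [← ofReal_norm, ← ENNReal.ofReal_pow (norm_nonneg _)]
    exact ENNReal.ofReal_le_ofReal (pow_le_pow_left₀ (norm_nonneg _) (hb s) 2)
  rw [ENNReal.ofReal_le_ofReal_iff (by positivity)] at h1
  exact le_of_sq_le_sq h1 (by positivity)

theorem maps_proj {ω : Set Ω} (hω : MeasurableSet ω) (u : H) :
    E.Maps (ω.indicator fun _ => 1) u (E.proj ω u) := by
  refine ⟨?_, fun v => ?_⟩
  · refine Integrable.of_bound (C := 1)
      ((measurable_const.indicator hω).norm.pow_const 2).aestronglyMeasurable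
      (Eventually.of_forall fun s => ?_)
    by_cases hs : s ∈ ω <;> simp [hs]
  · rw [VectorMeasure.integral_indicator_const _ hω, ContinuousLinearMap.mul_apply', one_mul,
      E.measure_apply _ _ hω]

/-- The adjoint of `∫ φ dE` contains `∫ φ̄ dE`. -/
theorem Maps.inner_eq (hφ : Measurable φ) (h : E.Maps φ u w)
    (h' : E.Maps (fun s => starRingEnd ℂ (φ s)) v z) : inner ℂ v w = inner ℂ z u := by
  rw [← inner_conj_symm z u, h'.2, h.2, integral_conj_of_apply_eq_conj
    (fun ω hω => E.measure_swap v u hω) (integrable_measure hφ h.1 v), Complex.conj_conj]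

theorem IsIntegral.mem_graph_iff {T : H →ₗ.[ℂ] H} (hT : E.IsIntegral φ T) :
    (u, w) ∈ T.graph ↔ E.Maps φ u w := by
  constructor
  · intro h
    obtain ⟨x, hx, hxw⟩ := T.mem_graph_iff.1 h
    simp only at hx hxw
    subst hx
    subst hxw
    exact ⟨(hT.1 x).1 x.2, fun v => hT.2 x v⟩
  · intro h
    have hu : u ∈ T.domain := (hT.1 u).2 h.1
    refine T.mem_graph_iff.2 ⟨⟨u, hu⟩, rfl, ?_⟩
    exact Maps.unique ⟨h.1, fun v => hT.2 ⟨u, hu⟩ v⟩ h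

theorem isIntegral_of_forall_mem_graph_iff {T : H →ₗ.[ℂ] H} (hφ : Measurable φ)
    (hT : ∀ u w, (u, w) ∈ T.graph ↔ E.Maps φ u w) : E.IsIntegral φ T := by
  refine ⟨fun u => ⟨fun hu => ?_, fun hu => ?_⟩, fun u v => ?_⟩
  · exact ((hT _ _).1 (T.mem_graph ⟨u, hu⟩)).1
  · obtain ⟨w, hw⟩ := exists_maps hφ hu
    exact T.mem_domain_of_mem_graph ((hT _ _).2 hw)
  · exact ((hT _ _).1 (T.mem_graph u)).2 v

variable (E) in
-- `integral` is a choice, so an operator with the property has to be exhibited: the pairs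
-- satisfying `Maps` form a subspace without vertical vectors, hence a graph.
theorem isIntegral_integral (hφ : Measurable φ) : E.IsIntegral φ (E.integral φ) := by
  have h0 : E.Maps φ 0 0 := by
    have hd : E.diag (0 : H) = 0 := by
      rw [← Measure.measure_univ_eq_zero, E.diag_univ]
      simp
    have hi : Integrable (fun s => ‖φ s‖ ^ 2) (E.diag (0 : H)) := by
      rw [hd]
      exact integrable_zero_measure
    obtain ⟨w, hw⟩ := exists_maps hφ hi
    simpa using hw.smul_vec hφ 0
  let g : Submodule ℂ (H × H) :=
    { carrier := {p | E.Maps φ p.1 p.2}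
      zero_mem' := h0
      add_mem' := fun hp hq => Maps.add_vec hφ hp hq
      smul_mem' := fun c _ hp => Maps.smul_vec hφ hp c }
  have hg : ∀ x ∈ g, x.1 = 0 → x.2 = 0 := by
    rintro ⟨x, y⟩ hx rfl
    exact Maps.unique hx h0
  have : ∃ T, E.IsIntegral φ T := ⟨g.toLinearPMap, isIntegral_of_forall_mem_graph_iff hφ
    fun u w => by rw [Submodule.toLinearPMap_graph_eq g hg]; rfl⟩
  exact Classical.epsilon_spec this

theorem mem_graph_integral_iff (hφ : Measurable φ) :
    (u, w) ∈ (E.integral φ).graph ↔ E.Maps φ u w :=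
  (E.isIntegral_integral hφ).mem_graph_iff

end Maps

/-! ### Bounded multipliers -/

section Bounded

variable {φ ψ : Ω → ℂ} {u w : H}

/-- The bounded measurable functions. -/
def IsBddMeasurable (φ : Ω → ℂ) : Prop :=
  Measurable φ ∧ ∃ C : ℝ, ∀ s, ‖φ s‖ ≤ C

theorem IsBddMeasurable.of_le (hφ : Measurable φ) {C : ℝ} (h : ∀ s, ‖φ s‖ ≤ C) :
    IsBddMeasurable φ := ⟨hφ, C, h⟩

theorem IsBddMeasurable.conj (hφ : IsBddMeasurable φ) :
    IsBddMeasurable fun s => starRingEnd ℂ (φ s) := by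
  obtain ⟨h, C, hC⟩ := hφ
  exact ⟨Complex.continuous_conj.measurable.comp h, C, fun s => by rw [RCLike.norm_conj]; exact hC s⟩

theorem IsBddMeasurable.mul (hφ : IsBddMeasurable φ) (hψ : IsBddMeasurable ψ) :
    IsBddMeasurable fun s => φ s * ψ s := by
  obtain ⟨h, C, hC⟩ := hφ
  obtain ⟨h', C', hC'⟩ := hψ
  refine ⟨h.mul h', |C| * |C'|, fun s => ?_⟩
  rw [norm_mul]
  exact mul_le_mul ((hC s).trans (le_abs_self C)) ((hC' s).trans (le_abs_self C'))
    (norm_nonneg _) (abs_nonneg _)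

theorem IsBddMeasurable.add (hφ : IsBddMeasurable φ) (hψ : IsBddMeasurable ψ) :
    IsBddMeasurable fun s => φ s + ψ s := by
  obtain ⟨h, C, hC⟩ := hφ
  obtain ⟨h', C', hC'⟩ := hψ
  exact ⟨h.add h', C + C', fun s => (norm_add_le _ _).trans (add_le_add (hC s) (hC' s))⟩

theorem IsBddMeasurable.const (c : ℂ) : IsBddMeasurable fun _ : Ω => c :=
  ⟨measurable_const, ‖c‖, fun _ => le_rfl⟩

theorem IsBddMeasurable.indicator {ω : Set Ω} (hω : MeasurableSet ω) :
    IsBddMeasurable (ω.indicator fun _ => (1 : ℂ)) := by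
  refine ⟨measurable_const.indicator hω, 1, fun s => ?_⟩
  by_cases hs : s ∈ ω <;> simp [hs]

variable (E : SpectralMeasure Ω H)

theorem exists_maps_of_isBddMeasurable (hφ : IsBddMeasurable φ) (u : H) : ∃ w, E.Maps φ u w := by
  obtain ⟨h, C, hC⟩ := hφ
  refine exists_maps h (Integrable.of_bound (C := C ^ 2) (by fun_prop)
    (Eventually.of_forall fun s => ?_))
  rw [Real.norm_of_nonneg (by positivity)]
  exact pow_le_pow_left₀ (norm_nonneg _) (hC s) 2

theorem exists_boundedCalculus (hφ : IsBddMeasurable φ) :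
    ∃ T : H →L[ℂ] H, ∀ u, E.Maps φ u (T u) := by
  choose T hT using E.exists_maps_of_isBddMeasurable hφ
  obtain ⟨C, hC⟩ := hφ.2
  let T' : H →ₗ[ℂ] H :=
    { toFun := T
      map_add' := fun u v => (hT (u + v)).unique ((hT u).add_vec hφ.1 (hT v))
      map_smul' := fun c u => (hT (c • u)).unique ((hT u).smul_vec hφ.1 c) }
  exact ⟨T'.mkContinuous |C| fun u => (hT u).norm_le hφ.1 (abs_nonneg _)
    fun s => (hC s).trans (le_abs_self _), hT⟩

open Classical in
/-- The bounded operator `∫ φ dE`, for bounded measurable `φ`. -/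
def bdd (φ : Ω → ℂ) : H →L[ℂ] H :=
  if h : IsBddMeasurable φ then (E.exists_boundedCalculus h).choose else 0

theorem maps_bdd (hφ : IsBddMeasurable φ) (u : H) : E.Maps φ u (E.bdd φ u) := by
  rw [bdd, dif_pos hφ]
  exact (E.exists_boundedCalculus hφ).choose_spec u

variable {E} in
theorem Maps.eq_bdd (hφ : IsBddMeasurable φ) (h : E.Maps φ u w) : w = E.bdd φ u :=
  h.unique (E.maps_bdd hφ u)

theorem bdd_bdd (hφ : IsBddMeasurable φ) (hψ : IsBddMeasurable ψ) (u : H) :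
    E.bdd ψ (E.bdd φ u) = E.bdd (fun s => ψ s * φ s) u :=
  (((E.maps_bdd hφ u).comp_iff hφ.1 hψ.1).1 (E.maps_bdd hψ _)).eq_bdd (hψ.mul hφ)

theorem bdd_add (hφ : IsBddMeasurable φ) (hψ : IsBddMeasurable ψ) (u : H) :
    E.bdd (fun s => φ s + ψ s) u = E.bdd φ u + E.bdd ψ u :=
  (((E.maps_bdd hφ u).add hφ.1 hψ.1 (E.maps_bdd hψ u)).eq_bdd (hφ.add hψ)).symm

theorem bdd_const_mul (hφ : IsBddMeasurable φ) (c : ℂ) (u : H) :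
    E.bdd (fun s => c * φ s) u = c • E.bdd φ u :=
  (((E.maps_bdd hφ u).const_mul hφ.1 c).eq_bdd ((IsBddMeasurable.const c).mul hφ)).symm

theorem bdd_sub (hφ : IsBddMeasurable φ) (hψ : IsBddMeasurable ψ) (u : H) :
    E.bdd (fun s => φ s - ψ s) u = E.bdd φ u - E.bdd ψ u := by
  refine (((E.maps_bdd hφ u).sub hφ.1 hψ.1 (E.maps_bdd hψ u)).eq_bdd ?_).symm
  simpa [sub_eq_add_neg] using hφ.add ((IsBddMeasurable.const (-1)).mul hψ)

theorem bdd_indicator {ω : Set Ω} (hω : MeasurableSet ω) (u : H) :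
    E.bdd (ω.indicator fun _ => 1) u = E.proj ω u :=
  ((maps_proj hω u).eq_bdd (.indicator hω)).symm

theorem bdd_one (u : H) : E.bdd (fun _ => 1) u = u := by
  have h := E.bdd_indicator MeasurableSet.univ u
  rw [Set.indicator_univ, E.proj_univ] at h
  exact h

theorem inner_bdd_left (hφ : IsBddMeasurable φ) (u v : H) :
    inner ℂ (E.bdd φ u) v = inner ℂ u (E.bdd (fun s => starRingEnd ℂ (φ s)) v) :=
  ((E.maps_bdd hφ.conj v).inner_eq hφ.conj.1 (by simpa using E.maps_bdd hφ u)).symm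

theorem norm_bdd_le (hφ : Measurable φ) {C : ℝ} (hC : 0 ≤ C) (h : ∀ s, ‖φ s‖ ≤ C) (u : H) :
    ‖E.bdd φ u‖ ≤ C * ‖u‖ :=
  (E.maps_bdd (.of_le hφ h) u).norm_le hφ hC h

end Bounded

end SpectralMeasure

end

section

variable {H : Type*} [NormedAddCommGroup H] [InnerProductSpace ℂ H]

/-! ### Construction of spectral measures -/

theorem inner_self_eq_ofReal (u : H) : inner ℂ u u = ((‖u‖ ^ 2 : ℝ) : ℂ) := by
  rw [inner_self_eq_norm_sq_to_K]
  simp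

/-- Complex polarization. It reduces operator identities for projections to their diagonal matrix
elements. -/
theorem clm_ext_inner_self {S T : H →L[ℂ] H} (h : ∀ u, inner ℂ u (S u) = inner ℂ u (T u)) :
    S = T := by
  have : (S : H →ₗ[ℂ] H) = (T : H →ₗ[ℂ] H) := by
    rw [← ext_inner_map]
    intro x
    have := congrArg (starRingEnd ℂ) (h x)
    rwa [inner_conj_symm, inner_conj_symm] at this
  exact ContinuousLinearMap.coe_injective this

variable [CompleteSpace H]

/-- A family of projections is a spectral measure as soon as its diagonal matrix elements are finite
positive measures. -/
def SpectralMeasure.ofMeasures {Ω : Type*} [MeasurableSpace Ω] (P : Set Ω → H →L[ℂ] H)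
    (m : H → Measure Ω) (hfin : ∀ u, IsFiniteMeasure (m u))
    (hP : ∀ ω, MeasurableSet ω → IsStarProjection (P ω))
    (hm : ∀ u ω, MeasurableSet ω → inner ℂ u (P ω u) = ((m u ω).toReal : ℂ))
    (huniv : ∀ u, (m u Set.univ).toReal = ‖u‖ ^ 2)
    (hinter : ∀ ω₁ ω₂, MeasurableSet ω₁ → MeasurableSet ω₂ → P (ω₁ ∩ ω₂) = P ω₁ * P ω₂) :
    SpectralMeasure Ω H where
  proj := P
  isStarProjection := hP
  proj_empty := clm_ext_inner_self fun u => by simp [hm u ∅ MeasurableSet.empty]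
  proj_univ := clm_ext_inner_self fun u => by
    rw [hm u _ MeasurableSet.univ, huniv, one_apply_eq_self, inner_self_eq_ofReal]
  proj_inter := hinter
  proj_union ω₁ ω₂ h₁ h₂ h := clm_ext_inner_self fun u => by
    rw [hm u _ (h₁.union h₂), add_apply, inner_add_right, hm u _ h₁,
      hm u _ h₂, measure_union (Set.disjoint_iff_inter_eq_empty.2 h) h₂,
      ENNReal.toReal_add (measure_ne_top _ _) (measure_ne_top _ _), Complex.ofReal_add]
  exists_complexMeasure u v := by
    let κ : H → ComplexMeasure Ω := fun x =>
      SignedMeasure.toComplexMeasure (m x).toSignedMeasure 0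
    have hκ : ∀ x ω, MeasurableSet ω → κ x ω = inner ℂ (P ω x) x := by
      intro x ω hω
      rw [← inner_conj_symm, hm x ω hω, Complex.conj_ofReal]
      apply Complex.ext <;>
        simp [κ, SignedMeasure.toComplexMeasure_apply, Measure.toSignedMeasure_apply_measurable hω,
          Measure.real]
    -- The off-diagonal measure is the polarization of the diagonal ones.
    refine ⟨(1 / 4 : ℂ) • (κ (u + v) - κ (u - v) + Complex.I • κ (u + Complex.I • v) -
      Complex.I • κ (u - Complex.I • v)), fun ω hω => ?_⟩
    have hsa : inner ℂ v (P ω u) = inner ℂ (P ω v) u := by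
      have h := (hP ω hω).isSelfAdjoint
      rw [ContinuousLinearMap.isSelfAdjoint_iff'] at h
      conv_rhs => rw [← h]
      rw [ContinuousLinearMap.adjoint_inner_left]
    have hpol := inner_map_polarization (P ω : H →ₗ[ℂ] H) u v
    simp only [ContinuousLinearMap.coe_coe] at hpol
    rw [hsa, hpol]
    simp only [smul_apply, sub_apply, add_apply, hκ _ ω hω, smul_eq_mul]
    ring

/-! ### Spectral measure of a representation of `C(X)`, `X` compact metric -/

section Representation

variable {X : Type*} [MetricSpace X]
variable (Φ : C(X, ℝ) →⋆ₐ[ℝ] (H →L[ℂ] H))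

theorem inner_representation_left (φ : C(X, ℝ)) (u v : H) :
    inner ℂ (Φ φ u) v = inner ℂ u (Φ φ v) := by
  have h : IsSelfAdjoint (Φ φ) := by
    rw [IsSelfAdjoint, ← map_star]
    congr 1
  rw [ContinuousLinearMap.isSelfAdjoint_iff'] at h
  conv_lhs => rw [← h]
  rw [ContinuousLinearMap.adjoint_inner_left]

theorem inner_representation_mul (φ ψ : C(X, ℝ)) (u v : H) :
    inner ℂ (Φ φ u) (Φ ψ v) = inner ℂ u (Φ (φ * ψ) v) := by
  rw [inner_representation_left, map_mul]
  rfl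

variable [CompactSpace X] [MeasurableSpace X] [BorelSpace X]

/-- Riesz–Markov: if `φ ≥ 0` then `φ = ψ²` and the functional takes the value `‖Φ(ψ)u‖² ≥ 0`. -/
theorem exists_scalar_measure (u : H) : ∃ m : Measure X, IsFiniteMeasure m ∧
    ∀ φ : C(X, ℝ), inner ℂ u (Φ φ u) = ((∫ x, φ x ∂m : ℝ) : ℂ) := by
  have hreal : ∀ φ : C(X, ℝ), inner ℂ u (Φ φ u) = (((inner ℂ u (Φ φ u)).re : ℝ) : ℂ) := by
    intro φ
    refine (Complex.conj_eq_iff_re.1 ?_).symm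
    rw [inner_conj_symm, inner_representation_left]
  have hnonneg : ∀ φ : C(X, ℝ), 0 ≤ φ → 0 ≤ (inner ℂ u (Φ φ u)).re := by
    intro φ hφ
    let ψ : C(X, ℝ) := ⟨fun x => √(φ x), by fun_prop⟩
    have : φ = ψ * ψ := by
      ext x
      exact (Real.mul_self_sqrt (hφ x)).symm
    rw [this, ← inner_representation_mul, inner_self_eq_ofReal, Complex.ofReal_re]
    positivity
  let Λ : CompactlySupportedContinuousMap X ℝ →ₚ[ℝ] ℝ :=
    { toFun := fun g => (inner ℂ u (Φ g.toContinuousMap u)).re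
      map_add' := fun g g' => by
        have : (g + g').toContinuousMap = g.toContinuousMap + g'.toContinuousMap := rfl
        rw [this, map_add, add_apply, inner_add_right, Complex.add_re]
      map_smul' := fun c g => by
        have : (c • g).toContinuousMap = c • g.toContinuousMap := rfl
        rw [this, map_smul, smul_apply, ← Complex.coe_smul, inner_smul_right, Complex.re_ofReal_mul]
        rfl
      monotone' := fun g g' h => by
        have h1 := hnonneg (g'.toContinuousMap - g.toContinuousMap) fun x => by
          simpa using h x
        rw [map_sub, sub_apply, inner_sub_right, Complex.sub_re] at h1
        exact sub_nonneg.1 h1 }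
  refine ⟨RealRMK.rieszMeasure Λ, inferInstance, fun φ => ?_⟩
  rw [hreal φ]
  congr 1
  let g : CompactlySupportedContinuousMap X ℝ :=
    { toContinuousMap := φ
      hasCompactSupport' := HasCompactSupport.of_compactSpace _ }
  exact (RealRMK.integral_rieszMeasure Λ g).symm

/-- A measure representing the functional `φ ↦ ⟨Φ(φ)u, u⟩`. -/
def scalarMeasure (u : H) : Measure X := (exists_scalar_measure Φ u).choose

instance (u : H) : IsFiniteMeasure (scalarMeasure Φ u) :=
  (exists_scalar_measure Φ u).choose_spec.1

theorem inner_representation (u : H) (φ : C(X, ℝ)) :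
    inner ℂ u (Φ φ u) = ((∫ x, φ x ∂(scalarMeasure Φ u) : ℝ) : ℂ) :=
  (exists_scalar_measure Φ u).choose_spec.2 φ

theorem scalarMeasure_univ (u : H) : (scalarMeasure Φ u Set.univ).toReal = ‖u‖ ^ 2 := by
  have := inner_representation Φ u 1
  rw [map_one, one_apply_eq_self, inner_self_eq_ofReal, Complex.ofReal_inj] at this
  simpa [Measure.real] using this.symm

/-- The class of a continuous function in `L²`. -/
def contL2 (m : Measure X) [IsFiniteMeasure m] (φ : C(X, ℝ)) : Lp ℝ 2 m :=
  ContinuousMap.toLp 2 m ℝ φ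

/-- So `φ ↦ Φ(φ)u` is isometric for the norm of `L²(m_u)`, and the projection of `ω` applied to `u`
can be defined as the image of the indicator of `ω`. -/
theorem inner_contL2 (u : H) (φ ψ : C(X, ℝ)) :
    inner ℂ (Φ φ u) (Φ ψ u) =
      ((inner ℝ (contL2 (scalarMeasure Φ u) φ) (contL2 (scalarMeasure Φ u) ψ) : ℝ) : ℂ) := by
  rw [inner_representation_mul, inner_representation]
  congr 1
  rw [contL2, contL2, ContinuousMap.inner_toLp]
  exact integral_congr_ae (Eventually.of_forall fun x => by simp [mul_comm])

theorem norm_contL2 (u : H) (φ : C(X, ℝ)) : ‖contL2 (scalarMeasure Φ u) φ‖ = ‖Φ φ u‖ := by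
  have h := inner_contL2 Φ u φ φ
  rw [inner_self_eq_ofReal, real_inner_self_eq_norm_sq] at h
  have h' : ‖Φ φ u‖ ^ 2 = ‖contL2 (scalarMeasure Φ u) φ‖ ^ 2 := by exact_mod_cast h
  exact ((sq_eq_sq₀ (norm_nonneg _) (norm_nonneg _)).1 h').symm

/-- The continuous functions `φ i` converge to the indicator function of `ω` in all the spaces
`L²(m_u)`. -/
def ApproxIndicator {ι : Type*} [Preorder ι] (ω : Set X) (hω : MeasurableSet ω)
    (φ : ι → C(X, ℝ)) : Prop :=
  ∀ u : H, Tendsto (fun i => contL2 (scalarMeasure Φ u) (φ i)) atTop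
    (𝓝 (indicatorConstLp 2 hω (measure_ne_top (scalarMeasure Φ u) ω) 1))

open Classical in
-- A single net has to serve all vectors, so that the limit is linear in `u`. An index is a finite
-- set of vectors with a precision `n`; the approximation is done in `L²` of the sum of their
-- measures.
theorem exists_approxIndicator (ω : Set X) (hω : MeasurableSet ω) :
    ∃ φ : Finset H × ℕ → C(X, ℝ), ApproxIndicator Φ ω hω φ := by
  have hex : ∀ i : Finset H × ℕ, ∃ φ : C(X, ℝ),
      eLpNorm (ω.indicator (fun _ => (1 : ℝ)) - ⇑φ) 2 (∑ u ∈ i.1, scalarMeasure Φ u) ≤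
        ((i.2 : ENNReal) + 1)⁻¹ := by
    intro i
    obtain ⟨g, hg, -⟩ := (memLp_indicator_const (2 : ENNReal) hω (1 : ℝ)
      (Or.inr (measure_ne_top (∑ u ∈ i.1, scalarMeasure Φ u) ω))).exists_boundedContinuous_eLpNorm_sub_le
        (by simp) (ε := ((i.2 : ENNReal) + 1)⁻¹) (by simp)
    exact ⟨g.toContinuousMap, hg⟩
  choose φ hφ using hex
  refine ⟨φ, fun u => ?_⟩
  rw [tendsto_iff_edist_tendsto_0]
  have hlim : Tendsto (fun i : Finset H × ℕ => ((i.2 : ENNReal) + 1)⁻¹) atTop (𝓝 0) := by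
    have h1 : Tendsto (fun n : ℕ => ((n : ENNReal) + 1)⁻¹) atTop (𝓝 0) := by
      have := (tendsto_add_atTop_iff_nat 1).2 ENNReal.tendsto_inv_nat_nhds_zero
      simpa using this
    rw [← prod_atTop_atTop_eq]
    exact h1.comp tendsto_snd
  refine tendsto_of_tendsto_of_tendsto_of_le_of_le' tendsto_const_nhds hlim
    (Eventually.of_forall fun _ => bot_le) ?_
  filter_upwards [eventually_ge_atTop (({u}, 0) : Finset H × ℕ)] with i hi
  refine le_trans ?_ (hφ i)
  have hu : u ∈ i.1 := hi.1 (Finset.mem_singleton_self u)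
  have hle : scalarMeasure Φ u ≤ ∑ u ∈ i.1, scalarMeasure Φ u :=
    Finset.single_le_sum (f := fun u => scalarMeasure Φ u) (fun _ _ => bot_le) hu
  refine le_trans (le_of_eq ?_) (eLpNorm_mono_measure _ hle)
  rw [edist_comm, Lp.edist_def]
  refine eLpNorm_congr_ae ?_
  filter_upwards [indicatorConstLp_coeFn (p := 2) (hs := hω)
    (hμs := measure_ne_top (scalarMeasure Φ u) ω) (c := (1 : ℝ)),
    ContinuousMap.coeFn_toLp (p := 2) (𝕜 := ℝ) (scalarMeasure Φ u) (φ i)] with x h1 h2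
  simp only [Pi.sub_apply, h1]
  rw [contL2, h2]

theorem exists_limit_of_approxIndicator {ι : Type*} [SemilatticeSup ι] [Nonempty ι] {ω : Set X}
    {hω : MeasurableSet ω} {φ : ι → C(X, ℝ)} (h : ApproxIndicator Φ ω hω φ) (u : H) :
    ∃ w, Tendsto (fun i => Φ (φ i) u) atTop (𝓝 w) := by
  have hc := (h u).cauchySeq
  refine cauchySeq_tendsto_of_complete (Metric.cauchySeq_iff'.2 fun ε hε => ?_)
  obtain ⟨N, hN⟩ := Metric.cauchySeq_iff'.1 hc ε hε
  refine ⟨N, fun n hn => ?_⟩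
  have := hN n hn
  rw [dist_eq_norm] at this ⊢
  have hsub : ∀ φ ψ : C(X, ℝ), contL2 (scalarMeasure Φ u) φ - contL2 (scalarMeasure Φ u) ψ =
      contL2 (scalarMeasure Φ u) (φ - ψ) := fun φ ψ => (map_sub _ _ _).symm
  rw [hsub, norm_contL2, map_sub] at this
  exact this

/-- The net of continuous functions used to define the projection of `ω`. -/
def approxNet (ω : Set X) (hω : MeasurableSet ω) : Finset H × ℕ → C(X, ℝ) :=
  (exists_approxIndicator Φ ω hω).choose

theorem approxIndicator_approxNet (ω : Set X) (hω : MeasurableSet ω) :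
    ApproxIndicator Φ ω hω (approxNet Φ ω hω) :=
  (exists_approxIndicator Φ ω hω).choose_spec

theorem approxIndicator_one {ι : Type*} [Preorder ι] :
    ApproxIndicator Φ Set.univ MeasurableSet.univ fun _ : ι => (1 : C(X, ℝ)) := by
  intro u
  have : contL2 (scalarMeasure Φ u) 1 = indicatorConstLp 2 MeasurableSet.univ
      (measure_ne_top (scalarMeasure Φ u) Set.univ) 1 := by
    refine Lp.ext ?_
    filter_upwards [indicatorConstLp_coeFn (p := 2) (hs := MeasurableSet.univ)
      (hμs := measure_ne_top (scalarMeasure Φ u) Set.univ) (c := (1 : ℝ)),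
      ContinuousMap.coeFn_toLp (p := 2) (𝕜 := ℝ) (scalarMeasure Φ u)
        (1 : C(X, ℝ))] with x h1 h2
    rw [h1, contL2, h2]
    simp
  simp only [this]
  exact tendsto_const_nhds

/-- The inner product of two indicators in `L²(m_u)` is `m_u(ω ∩ ω')`. This one limit yields
contractivity, the diagonal elements (with `ω = X`) and multiplicativity of the projections. -/
theorem ApproxIndicator.tendsto_inner {ι : Type*} [Preorder ι] {ω ω' : Set X}
    {hω : MeasurableSet ω} {hω' : MeasurableSet ω'} {φ ψ : ι → C(X, ℝ)}
    (h : ApproxIndicator Φ ω hω φ) (h' : ApproxIndicator Φ ω' hω' ψ) (u : H) :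
    Tendsto (fun i => inner ℂ (Φ (φ i) u) (Φ (ψ i) u)) atTop
      (𝓝 (((scalarMeasure Φ u (ω ∩ ω')).toReal : ℝ) : ℂ)) := by
  simp_rw [inner_contL2]
  refine (Complex.continuous_ofReal.tendsto _).comp ?_
  have := (h u).inner (𝕜 := ℝ) (h' u)
  rwa [L2.real_inner_indicatorConstLp_one_indicatorConstLp_one] at this

open Classical in
theorem exists_limit_operator (ω : Set X) (hω : MeasurableSet ω) :
    ∃ P : H →L[ℂ] H, ∀ u, Tendsto (fun i => Φ (approxNet Φ ω hω i) u) atTop (𝓝 (P u)) := by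
  have happ := approxIndicator_approxNet Φ ω hω
  choose P hP using exists_limit_of_approxIndicator Φ happ
  let P' : H →ₗ[ℂ] H :=
    { toFun := P
      map_add' := fun u v => tendsto_nhds_unique (hP (u + v)) (by
        simp_rw [map_add]
        exact (hP u).add (hP v))
      map_smul' := fun c u => tendsto_nhds_unique (hP (c • u)) (by
        simp_rw [map_smul]
        exact (hP u).const_smul c) }
  refine ⟨P'.mkContinuous 1 fun u => ?_, hP⟩
  have h1 : inner ℂ (P u) (P u) = (((scalarMeasure Φ u (ω ∩ ω)).toReal : ℝ) : ℂ) :=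
    tendsto_nhds_unique ((hP u).inner (hP u)) (happ.tendsto_inner Φ happ u)
  rw [inner_self_eq_ofReal, Complex.ofReal_inj] at h1
  have h3 : ‖P u‖ ^ 2 ≤ ‖u‖ ^ 2 := by
    rw [h1, ← scalarMeasure_univ Φ u]
    exact ENNReal.toReal_mono (measure_ne_top _ _) (measure_mono (Set.subset_univ _))
  rw [one_mul]
  exact le_of_sq_le_sq h3 (norm_nonneg _)

open Classical in
/-- The spectral projection of a representation of `C(X)`. -/
def spectralProj (ω : Set X) : H →L[ℂ] H :=
  if hω : MeasurableSet ω then (exists_limit_operator Φ ω hω).choose else 0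

theorem tendsto_spectralProj {ω : Set X} (hω : MeasurableSet ω) (u : H) :
    Tendsto (fun i => Φ (approxNet Φ ω hω i) u) atTop (𝓝 (spectralProj Φ ω u)) := by
  rw [spectralProj, dif_pos hω]
  exact (exists_limit_operator Φ ω hω).choose_spec u

open Classical in
theorem inner_spectralProj_left {ω : Set X} (hω : MeasurableSet ω) (u v : H) :
    inner ℂ (spectralProj Φ ω u) v = inner ℂ u (spectralProj Φ ω v) := by
  refine tendsto_nhds_unique ((tendsto_spectralProj Φ hω u).inner tendsto_const_nhds) ?_
  simp_rw [inner_representation_left]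
  exact tendsto_const_nhds.inner (tendsto_spectralProj Φ hω v)

open Classical in
theorem inner_spectralProj {ω : Set X} (hω : MeasurableSet ω) (u : H) :
    inner ℂ u (spectralProj Φ ω u) = ((scalarMeasure Φ u ω).toReal : ℂ) := by
  have h := (approxIndicator_one Φ).tendsto_inner Φ (approxIndicator_approxNet Φ ω hω) u
  simp only [map_one, one_apply_eq_self, Set.univ_inter] at h
  exact tendsto_nhds_unique (tendsto_const_nhds.inner (tendsto_spectralProj Φ hω u)) h

open Classical in
theorem spectralProj_inter {ω₁ ω₂ : Set X} (h₁ : MeasurableSet ω₁) (h₂ : MeasurableSet ω₂) :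
    spectralProj Φ (ω₁ ∩ ω₂) = spectralProj Φ ω₁ * spectralProj Φ ω₂ := by
  refine clm_ext_inner_self fun u => ?_
  rw [inner_spectralProj Φ (h₁.inter h₂), mul_apply_eq_comp, ← inner_spectralProj_left Φ h₁]
  exact tendsto_nhds_unique ((approxIndicator_approxNet Φ ω₁ h₁).tendsto_inner Φ
    (approxIndicator_approxNet Φ ω₂ h₂) u)
    ((tendsto_spectralProj Φ h₁ u).inner (tendsto_spectralProj Φ h₂ u))

/-- The spectral measure of a representation of `C(X)`, for a compact metric space `X`. -/
def representationMeasure : SpectralMeasure X H :=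
  SpectralMeasure.ofMeasures (spectralProj Φ) (scalarMeasure Φ) (fun _ => inferInstance)
    (fun ω hω =>
      { isIdempotentElem := by
          rw [IsIdempotentElem, ← spectralProj_inter Φ hω hω, Set.inter_self]
        isSelfAdjoint := by
          rw [ContinuousLinearMap.isSelfAdjoint_iff_isSymmetric]
          exact fun u v => inner_spectralProj_left Φ hω u v })
    (fun u _ hω => inner_spectralProj Φ hω u) (scalarMeasure_univ Φ)
    (fun _ _ h₁ h₂ => spectralProj_inter Φ h₁ h₂)

theorem diag_representationMeasure (u : H) :
    (representationMeasure Φ).diag u = scalarMeasure Φ u :=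
  variation_eq_of_apply_eq fun ω hω => by
    rw [SpectralMeasure.measure_apply _ _ _ hω]
    exact inner_spectralProj Φ hω u

theorem isBddMeasurable_of_continuous (φ : C(X, ℝ)) :
    SpectralMeasure.IsBddMeasurable fun x => (φ x : ℂ) :=
  .of_le (by fun_prop) fun x => by
    rw [Complex.norm_real]
    exact φ.norm_coe_le_norm x

theorem bdd_representationMeasure (φ : C(X, ℝ)) :
    (representationMeasure Φ).bdd (fun x => (φ x : ℂ)) = Φ φ := by
  refine clm_ext_inner_self fun u => ?_
  rw [((representationMeasure Φ).maps_bdd (isBddMeasurable_of_continuous φ) u).2,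
    SpectralMeasure.integral_measure_self, diag_representationMeasure, inner_representation,
    integral_complex_ofReal]

end Representation

end

section

variable {H : Type*} [NormedAddCommGroup H] [InnerProductSpace ℂ H]

/-! ### The spectral measure of a strictly positive selfadjoint operator -/

section Inverse

variable {A : H →ₗ.[ℂ] H}

variable {B : H →L[ℂ] H}

theorem zero_mem_resolventSet (hB : ∀ x h, (x, h) ∈ A.graph ↔ x = B h) :
    (0 : ℂ) ∈ resolventSet A := by
  refine ⟨-B, fun y => ?_, fun x => ?_⟩
  · obtain ⟨x, hx, hx'⟩ := A.mem_graph_iff.1 ((hB (B (-y)) (-y)).2 rfl)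
    simp only at hx hx'
    have hxy : (-B) y = (x : H) := by rw [hx]; simp
    refine ⟨hxy ▸ x.2, ?_⟩
    have : (⟨(-B) y, hxy ▸ x.2⟩ : A.domain) = x := Subtype.ext hxy
    rw [this, hx']
    simp
  · have := (hB _ _).1 (A.mem_graph x)
    simp [← this]

/-- The resolvent sets of an operator and of its inverse. -/
theorem ofReal_mem_resolventSet_iff (hB : ∀ x h, (x, h) ∈ A.graph ↔ x = B h) {s : ℝ} (hs : s ≠ 0) :
    (s : ℂ) ∈ resolventSet A ↔ s⁻¹ ∉ _root_.spectrum ℝ B := by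
  have hsC : (s : ℂ) ≠ 0 := Complex.ofReal_ne_zero.2 hs
  have hAB : ∀ h, ∃ hx : B h ∈ A.domain, A ⟨B h, hx⟩ = h := by
    intro h
    obtain ⟨x, hx, hx'⟩ := A.mem_graph_iff.1 ((hB (B h) h).2 rfl)
    simp only at hx hx'
    refine ⟨hx ▸ x.2, ?_⟩
    have : (⟨B h, hx ▸ x.2⟩ : A.domain) = x := Subtype.ext hx.symm
    rw [this, hx']
  have hBA : ∀ x : A.domain, B (A x) = x := fun x => ((hB _ _).1 (A.mem_graph x)).symm
  have halg : algebraMap ℝ (H →L[ℂ] H) s⁻¹ = (s : ℂ)⁻¹ • (1 : H →L[ℂ] H) := by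
    rw [Algebra.algebraMap_eq_smul_one, ← Complex.coe_smul, Complex.ofReal_inv]
  rw [spectrum.mem_iff, not_not, halg]
  constructor
  · rintro ⟨R, hR, hR'⟩
    -- With `B = A⁻¹`: `(s⁻¹ - B)⁻¹ = s A (A - s)⁻¹ = s - s² (s - A)⁻¹`.
    refine ⟨⟨_, (s : ℂ) • 1 - (s : ℂ) ^ 2 • R, ?_, ?_⟩, rfl⟩
    · ext y
      obtain ⟨hy, hy'⟩ := hR y
      have h1 := hBA ⟨R y, hy⟩
      have h2 : A ⟨R y, hy⟩ = (s : ℂ) • R y - y := by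
        rw [eq_sub_iff_add_eq, add_comm]
        exact (sub_eq_iff_eq_add.1 hy').symm
      rw [h2, map_sub, map_smul] at h1
      simp only at h1
      have h3 : R y = (s : ℂ) • B (R y) - B y := h1.symm
      simp only [mul_apply_eq_comp, sub_apply, smul_apply, one_apply_eq_self, map_sub, map_smul,
        smul_sub, smul_smul]
      have h4 : (s : ℂ) ^ 2 • B (R y) = (s : ℂ) • R y + (s : ℂ) • B y := by
        rw [← smul_add]
        nth_rw 2 [h3]
        rw [sub_add_cancel, smul_smul, sq]
      rw [h4, mul_inv_cancel₀ hsC, show (s : ℂ) ^ 2 * (s : ℂ)⁻¹ = s by field_simp, one_smul]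
      abel
    · ext y
      obtain ⟨hx, hx'⟩ := hAB y
      have h1 := hR' ⟨B y, hx⟩
      rw [hx', map_sub, map_smul] at h1
      simp only at h1
      simp only [mul_apply_eq_comp, sub_apply, smul_apply, one_apply_eq_self, map_sub, map_smul,
        smul_sub, smul_smul]
      have h4 : (s : ℂ) ^ 2 • R (B y) = (s : ℂ) • R y + (s : ℂ) • B y := by
        rw [← smul_add, ← sub_eq_iff_eq_add'.1 h1, smul_smul, sq]
      rw [h4, inv_mul_cancel₀ hsC, show (s : ℂ)⁻¹ * (s : ℂ) ^ 2 = s by field_simp, one_smul]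
      abel
  · rintro ⟨U, hU⟩
    set C : H →L[ℂ] H := ((U⁻¹ : (H →L[ℂ] H)ˣ) : H →L[ℂ] H) with hC
    have hUC : ∀ y, (s : ℂ)⁻¹ • C y - B (C y) = y := by
      intro y
      have := DFunLike.congr_fun (U.mul_inv) y
      rw [hU] at this
      simpa using this
    have hCU : ∀ y, (s : ℂ)⁻¹ • C y - C (B y) = y := by
      intro y
      have := DFunLike.congr_fun (U.inv_mul) y
      rw [hU] at this
      simpa using this
    -- From `s - A = -s A (s⁻¹ - B)`.
    refine ⟨-((s : ℂ)⁻¹ • (B * C)), fun y => ?_, fun x => ?_⟩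
    · obtain ⟨hx, hx'⟩ := hAB (-((s : ℂ)⁻¹ • C y))
      have he : (-((s : ℂ)⁻¹ • (B * C))) y = B (-((s : ℂ)⁻¹ • C y)) := by simp
      refine ⟨he ▸ hx, ?_⟩
      have he' : (⟨(-((s : ℂ)⁻¹ • (B * C))) y, he ▸ hx⟩ : A.domain) =
        ⟨B (-((s : ℂ)⁻¹ • C y)), hx⟩ := Subtype.ext he
      rw [he', hx']
      conv_rhs => rw [← hUC y]
      simp only [neg_apply, smul_apply, mul_apply_eq_comp, smul_neg, smul_smul,
        mul_inv_cancel₀ hsC, one_smul]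
      abel
    · have h1 := hBA x
      have h2 := hCU (A x)
      rw [h1] at h2
      have h3 : C ((s : ℂ) • (x : H) - A x) = -((s : ℂ) • A x) := by
        rw [map_sub, map_smul]
        have : C (x : H) = (s : ℂ)⁻¹ • C (A x) - A x := by
          rw [eq_sub_iff_add_eq, add_comm]
          exact (sub_eq_iff_eq_add.1 h2).symm
        rw [this, smul_sub, smul_smul, mul_inv_cancel₀ hsC, one_smul]
        abel
      simp only [neg_apply, smul_apply, mul_apply_eq_comp, h3, map_neg, map_smul, h1, smul_neg,
        smul_smul, inv_mul_cancel₀ hsC, one_smul, neg_neg]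

theorem realSpectrum_ne_zero (hB : ∀ x h, (x, h) ∈ A.graph ↔ x = B h) {s : ℝ}
    (hs : s ∈ realSpectrum A) : s ≠ 0 := by
  rintro rfl
  exact hs (by simpa using zero_mem_resolventSet hB)

theorem mem_realSpectrum_iff (hB : ∀ x h, (x, h) ∈ A.graph ↔ x = B h) (s : ℝ) :
    s ∈ realSpectrum A ↔ s ≠ 0 ∧ s⁻¹ ∈ _root_.spectrum ℝ B := by
  constructor
  · intro hs
    have h0 := realSpectrum_ne_zero hB hs
    exact ⟨h0, not_not.1 fun h => hs ((ofReal_mem_resolventSet_iff hB h0).2 h)⟩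
  · rintro ⟨h0, hs⟩ h
    exact (ofReal_mem_resolventSet_iff hB h0).1 h hs

/-- The map `s ↦ 1/s` from the spectrum of `A` to the spectrum of its inverse. -/
def invMap (hB : ∀ x h, (x, h) ∈ A.graph ↔ x = B h) (s : realSpectrum A) : _root_.spectrum ℝ B :=
  ⟨(s : ℝ)⁻¹, ((mem_realSpectrum_iff hB s).1 s.2).2⟩

theorem range_invMap (hB : ∀ x h, (x, h) ∈ A.graph ↔ x = B h) :
    Set.range (invMap hB) = {t : _root_.spectrum ℝ B | (t : ℝ) ≠ 0} := by
  ext t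
  constructor
  · rintro ⟨s, rfl⟩
    exact inv_ne_zero (realSpectrum_ne_zero hB s.2)
  · intro ht
    refine ⟨⟨(t : ℝ)⁻¹, (mem_realSpectrum_iff hB _).2 ⟨inv_ne_zero ht, ?_⟩⟩, ?_⟩
    · rw [inv_inv]
      exact t.2
    · exact Subtype.ext (inv_inv _)

variable [CompleteSpace H]

theorem inner_apply_left_of_isSelfAdjoint (hA : IsSelfAdjoint A) (x y : A.domain) :
    inner ℂ (A x) (y : H) = inner ℂ (x : H) (A y) := by
  have h := LinearPMap.adjoint_isFormalAdjoint hA.dense_domain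
  rw [LinearPMap.isSelfAdjoint_def.1 hA] at h
  exact h x y

theorem mem_graph_of_forall_inner (hA : IsSelfAdjoint A) {y h : H}
    (hy : ∀ x : A.domain, inner ℂ h (x : H) = inner ℂ y (A x)) : (y, h) ∈ A.graph := by
  have hmem := A.mem_adjoint_domain_of_exists y ⟨h, hy⟩
  have heq := LinearPMap.adjoint_apply_eq hA.dense_domain ⟨y, hmem⟩ hy
  have hg := A.adjoint.mem_graph ⟨y, hmem⟩
  rw [heq] at hg
  exact (congrArg (fun T : H →ₗ.[ℂ] H => (y, h) ∈ T.graph) (LinearPMap.isSelfAdjoint_def.1 hA)).mp hg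

/-- The inverse of a strictly positive selfadjoint operator. -/
theorem exists_inverse (hA : IsSelfAdjoint A) (hpos : IsStrictlyPositive A) :
    ∃ B : H →L[ℂ] H, IsSelfAdjoint B ∧ ∀ x h, (x, h) ∈ A.graph ↔ x = B h := by
  obtain ⟨c, hc, hcA⟩ := hpos
  have hbound : ∀ x h, (x, h) ∈ A.graph → ‖x‖ ≤ c⁻¹ * ‖h‖ := by
    intro x h hxh
    obtain ⟨y, rfl, rfl⟩ := A.mem_graph_iff.1 hxh
    have h1 := hcA y
    have h2 : (inner ℂ (y : H) (A y)).re ≤ ‖(y : H)‖ * ‖A y‖ :=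
      (Complex.re_le_norm _).trans (norm_inner_le_norm _ _)
    rcases eq_or_ne ‖(y : H)‖ 0 with h0 | h0
    · rw [h0]
      positivity
    · have h3 : 0 < ‖(y : H)‖ := lt_of_le_of_ne (norm_nonneg _) h0.symm
      rw [inv_mul_eq_div, le_div_iff₀ hc]
      have : ‖(y : H)‖ * (‖(y : H)‖ * c) ≤ ‖(y : H)‖ * ‖A y‖ := by nlinarith
      exact le_of_mul_le_mul_left this h3
  -- The range is closed, since the graph is closed and `A` is bounded below; its orthogonal
  -- complement is the kernel of `A* = A`, which is trivial.
  have hsurj : ∀ h, ∃ x, (x, h) ∈ A.graph := by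
    have hclosed : IsClosed (A.graph : Set (H × H)) := hA.isClosed
    have : CompleteSpace A.graph := hclosed.completeSpace_coe
    let q : A.graph →ₗ[ℂ] H := (LinearMap.snd ℂ H H).comp A.graph.subtype
    have hq : Continuous q := continuous_snd.comp continuous_subtype_val
    have hanti : AntilipschitzWith (max (Real.toNNReal c⁻¹) 1) q := by
      refine AddMonoidHomClass.antilipschitz_of_bound q fun p => ?_
      have hp := hbound p.1.1 p.1.2 p.2
      have h1 : ‖p‖ = max ‖p.1.1‖ ‖p.1.2‖ := rfl
      have h2 : ‖q p‖ = ‖p.1.2‖ := rfl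
      rw [h1, h2, NNReal.coe_max, Real.coe_toNNReal _ (by positivity)]
      refine max_le (hp.trans ?_) ?_
      · gcongr
        exact le_max_left _ _
      · exact le_mul_of_one_le_left (norm_nonneg _) (le_max_right _ _)
    have hrc : IsClosed (LinearMap.range q : Set H) :=
      hanti.isClosed_range (LinearMap.mkContinuous q 1 fun p => by
        rw [one_mul]; exact le_max_right _ _).uniformContinuous
    have : CompleteSpace (LinearMap.range q) := hrc.completeSpace_coe
    have htop : LinearMap.range q = ⊤ := by
      rw [← Submodule.orthogonal_eq_bot_iff, Submodule.eq_bot_iff]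
      intro y hy
      have hg : (y, (0 : H)) ∈ A.graph := mem_graph_of_forall_inner hA fun x => by
        rw [inner_zero_left, ← inner_conj_symm, hy (A x) ⟨⟨_, A.mem_graph x⟩, rfl⟩, map_zero]
      have := hbound y 0 hg
      simpa using this
    intro h
    have hh : h ∈ LinearMap.range q := htop ▸ Submodule.mem_top
    obtain ⟨⟨⟨x, h'⟩, hx⟩, rfl⟩ := hh
    exact ⟨x, hx⟩
  have huniq : ∀ x y h, (x, h) ∈ A.graph → (y, h) ∈ A.graph → x = y := by
    intro x y h hx hy
    have := hbound _ _ (A.graph.sub_mem hx hy)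
    simpa [sub_eq_zero] using this
  choose B hB using hsurj
  let B' : H →ₗ[ℂ] H :=
    { toFun := B
      map_add' := fun h k => huniq _ _ _ (hB (h + k)) (A.graph.add_mem (hB h) (hB k))
      map_smul' := fun c h => huniq _ _ _ (hB (c • h)) (A.graph.smul_mem c (hB h)) }
  refine ⟨B'.mkContinuous c⁻¹ fun h => hbound _ _ (hB h), ?_, fun x h => ⟨fun hx => ?_, ?_⟩⟩
  · rw [ContinuousLinearMap.isSelfAdjoint_iff_isSymmetric]
    intro h k
    change inner ℂ (B h) k = inner ℂ h (B k)
    obtain ⟨x, hx, hx'⟩ := A.mem_graph_iff.1 (hB h)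
    obtain ⟨y, hy, hy'⟩ := A.mem_graph_iff.1 (hB k)
    simp only at hx hx' hy hy'
    rw [← hx, ← hy, ← hx', ← hy', inner_apply_left_of_isSelfAdjoint hA]
  · exact huniq _ _ _ hx (hB h)
  · rintro rfl
    exact hB h

theorem measurableSet_realSpectrum (hB : ∀ x h, (x, h) ∈ A.graph ↔ x = B h) :
    MeasurableSet (realSpectrum A) := by
  have : realSpectrum A = {0}ᶜ ∩ (fun s => s⁻¹) ⁻¹' (_root_.spectrum ℝ B) := by
    ext s
    exact mem_realSpectrum_iff hB s
  rw [this]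
  exact (measurableSet_singleton 0).compl.inter
    (measurable_inv (spectrum.isClosed B).measurableSet)

theorem measurableEmbedding_invMap (hB : ∀ x h, (x, h) ∈ A.graph ↔ x = B h) :
    MeasurableEmbedding (invMap hB) where
  injective s s' h := Subtype.ext (inv_injective (congrArg Subtype.val h))
  measurable := (measurable_inv.comp measurable_subtype_coe).subtype_mk
  measurableSet_image' {ω} hω := by
    have he : MeasurableEmbedding fun s : realSpectrum A => (s : ℝ)⁻¹ :=
      (MeasurableEquiv.ofInvolutive _ inv_involutive measurable_inv).measurableEmbedding.comp
        (MeasurableEmbedding.subtype_coe (measurableSet_realSpectrum hB))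
    have : invMap hB '' ω = Subtype.val ⁻¹' ((fun s : realSpectrum A => (s : ℝ)⁻¹) '' ω) := by
      ext t
      constructor
      · rintro ⟨s, hs, rfl⟩
        exact ⟨s, hs, rfl⟩
      · rintro ⟨s, hs, hst⟩
        exact ⟨s, hs, Subtype.ext hst⟩
    rw [this]
    exact measurable_subtype_coe (he.measurableSet_image.2 hω)

/-- Take the spectral measure `F` of `B = A⁻¹` and transport it by `t = 1/s`. The map `s ↦ 1/s`
misses at most the point `0` of `σ(B)`, which has no mass because `B` is injective. -/
theorem exists_isSpectralMeasureOf (hA : IsSelfAdjoint A) (hpos : IsStrictlyPositive A) :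
    ∃ E : SpectralMeasure (realSpectrum A) H, IsSpectralMeasureOf A E := by
  obtain ⟨B, hBsa, hB⟩ := exists_inverse hA hpos
  let F : SpectralMeasure (_root_.spectrum ℝ B) H := representationMeasure (cfcHom hBsa)
  have hF : F.bdd (fun t => ((t : ℝ) : ℂ)) = B :=
    (bdd_representationMeasure (cfcHom hBsa) ((ContinuousMap.id ℝ).restrict _)).trans
      (cfcHom_id hBsa)
  have hid : SpectralMeasure.IsBddMeasurable fun t : _root_.spectrum ℝ B => ((t : ℝ) : ℂ) :=
    isBddMeasurable_of_continuous ((ContinuousMap.id ℝ).restrict _)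
  have hθ := measurableEmbedding_invMap hB
  have hzero_meas : MeasurableSet {t : _root_.spectrum ℝ B | (t : ℝ) = 0} :=
    measurable_subtype_coe (measurableSet_singleton 0)
  have hBinj : ∀ w, B w = 0 → w = 0 := by
    intro w hw
    have h1 := (hB 0 w).2 hw.symm
    exact A.graph_fst_eq_zero_snd h1 rfl
  -- `B F({0}) = ∫ t 1_{0}(t) dF = 0`.
  have hzero : F.proj {t | (t : ℝ) = 0} = 0 := by
    ext u
    refine hBinj _ ?_
    rw [← F.bdd_indicator hzero_meas]
    refine (DFunLike.congr_fun hF _).symm.trans ?_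
    rw [F.bdd_bdd (.indicator hzero_meas) hid]
    have : (fun t : _root_.spectrum ℝ B => ((t : ℝ) : ℂ) *
        Set.indicator {t : _root_.spectrum ℝ B | (t : ℝ) = 0} (fun _ => (1 : ℂ)) t) =
        fun t => (0 : ℂ) * (1 : ℂ) := by
      ext t
      by_cases ht : (t : ℝ) = 0 <;> simp [ht]
    rw [this, F.bdd_const_mul (.const 1), zero_smul]
  have hrange : F.proj (Set.range (invMap hB)) = 1 := by
    have h1 := F.proj_union {t | (t : ℝ) = 0} {t | (t : ℝ) ≠ 0} hzero_meas hzero_meas.compl (by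
      ext t
      simp)
    rw [hzero, zero_add] at h1
    rw [range_invMap, ← h1, ← F.proj_univ]
    congr 1
    ext t
    simpa using em _
  have hnull : ∀ u, F.diag u (Set.range (invMap hB))ᶜ = 0 := by
    intro u
    have : (Set.range (invMap hB))ᶜ = {t : _root_.spectrum ℝ B | (t : ℝ) = 0} := by
      rw [range_invMap]
      ext t
      simp
    rw [this, F.diag_apply u hzero_meas, hzero]
    simp
  let E : SpectralMeasure (realSpectrum A) H := SpectralMeasure.ofMeasures
    (fun ω => F.proj (invMap hB '' ω)) (fun u => (F.diag u).comap (invMap hB))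
    (fun u => ⟨by rw [hθ.comap_apply]; exact measure_lt_top _ _⟩)
    (fun ω hω => F.isStarProjection _ (hθ.measurableSet_image.2 hω))
    (fun u ω hω => by
      rw [hθ.comap_apply, F.diag_apply u (hθ.measurableSet_image.2 hω),
        F.inner_proj_self u (hθ.measurableSet_image.2 hω), ENNReal.toReal_ofReal (by positivity)])
    (fun u => by
      rw [hθ.comap_apply, Set.image_univ, F.diag_apply u hθ.measurableSet_range, hrange,
        ENNReal.toReal_ofReal (by positivity)]
      rfl)
    (fun ω₁ ω₂ h₁ h₂ => by
      rw [Set.image_inter hθ.injective, F.proj_inter _ _ (hθ.measurableSet_image.2 h₁)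
        (hθ.measurableSet_image.2 h₂)])
  have hEdiag : ∀ u, E.diag u = (F.diag u).comap (invMap hB) := by
    intro u
    ext ω hω
    rw [E.diag_apply u hω, hθ.comap_apply, F.diag_apply u (hθ.measurableSet_image.2 hω)]
    rfl
  have hinv : SpectralMeasure.IsBddMeasurable fun s : realSpectrum A => (((s : ℝ)⁻¹ : ℝ) : ℂ) := by
    obtain ⟨h, C, hC⟩ := hid
    exact ⟨h.comp hθ.measurable, C, fun s => hC (invMap hB s)⟩
  have hEB : E.bdd (fun s => (((s : ℝ)⁻¹ : ℝ) : ℂ)) = B := by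
    refine Eq.trans (clm_ext_inner_self fun u => ?_) hF
    have hmap := hθ.integral_map (μ := (F.diag u).comap (invMap hB))
      fun t : _root_.spectrum ℝ B => ((t : ℝ) : ℂ)
    rw [hθ.map_comap, Measure.restrict_eq_self_of_ae_mem (by rw [ae_iff]; exact hnull u)] at hmap
    rw [(E.maps_bdd hinv u).2, (F.maps_bdd hid u).2, E.integral_measure_self,
      F.integral_measure_self, hEdiag]
    exact hmap.symm
  have hsm : Measurable fun s : realSpectrum A => ((s : ℝ) : ℂ) := by fun_prop
  have hne : ∀ s : realSpectrum A, (s : ℝ) ≠ 0 := fun s => realSpectrum_ne_zero hB s.2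
  -- Now `∫ s⁻¹ dE = B`; multiplicativity and `s · s⁻¹ = 1` show that `∫ s dE` is the inverse of
  -- `B`.
  refine ⟨E, SpectralMeasure.isIntegral_of_forall_mem_graph_iff hsm fun u w => ?_⟩
  rw [hB]
  constructor
  · rintro rfl
    have h1 := E.maps_bdd hinv w
    rw [hEB] at h1
    rw [h1.comp_iff hinv.1 hsm]
    convert E.maps_bdd (.const 1) w using 1
    · ext s
      rw [← Complex.ofReal_mul, mul_inv_cancel₀ (hne s), Complex.ofReal_one]
    · rw [E.bdd_one]
  · intro h
    have h1 := (h.comp_iff hsm hinv.1).1 (E.maps_bdd hinv w)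
    rw [hEB] at h1
    have h2 := E.maps_bdd (.const 1) u
    rw [E.bdd_one] at h2
    refine h2.unique ?_
    convert h1 using 1
    ext s
    rw [← Complex.ofReal_mul, inv_mul_cancel₀ (hne s), Complex.ofReal_one]

end Inverse

end

section

variable {H : Type*} [NormedAddCommGroup H] [InnerProductSpace ℂ H] [CompleteSpace H]

/-! ### The spectral measure and the spectrum -/

section Support

theorem measurable_id_ofReal {σ : Set ℝ} : Measurable fun s : σ => ((s : ℝ) : ℂ) := by fun_prop

variable {A : H →ₗ.[ℂ] H} {E : SpectralMeasure (realSpectrum A) H}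

theorem IsSpectralMeasureOf.mem_graph_iff (hE : IsSpectralMeasureOf A E) {u w : H} :
    (u, w) ∈ A.graph ↔ E.Maps (fun s => ((s : ℝ) : ℂ)) u w :=
  SpectralMeasure.IsIntegral.mem_graph_iff hE

/-- The support of `E` is all of `σ(A)`: if `E(U) = 0`, the function `1/(s₀ - s)` cut off to the
complement of `U` is bounded, and its integral inverts `s₀ - A`. -/
theorem IsSpectralMeasureOf.exists_proj_eq_self (hE : IsSpectralMeasureOf A E)
    {U : Set (realSpectrum A)} (hU : IsOpen U) {s₀ : realSpectrum A} (hs₀ : s₀ ∈ U) :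
    ∃ u : H, u ≠ 0 ∧ E.proj U u = u := by
  by_contra hcon
  push Not at hcon
  have hUm : MeasurableSet U := hU.measurableSet
  have hU0 : E.proj U = 0 := by
    ext u
    by_contra h
    exact hcon _ h (E.proj_proj u hUm)
  have hUc : E.proj Uᶜ = 1 := by
    have h1 := E.proj_union U Uᶜ hUm hUm.compl (by simp)
    rw [hU0, zero_add, Set.union_compl_self, E.proj_univ] at h1
    exact h1.symm
  obtain ⟨ε, hε, hball⟩ := Metric.isOpen_iff.1 hU s₀ hs₀
  let g : realSpectrum A → ℂ := Uᶜ.indicator fun s => ((s₀ : ℝ) - (s : ℝ) : ℂ)⁻¹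
  have hdist : ∀ s ∈ Uᶜ, ε ≤ ‖((s₀ : ℝ) - (s : ℝ) : ℂ)‖ := by
    intro s hs
    by_contra h
    refine hs (hball ?_)
    rw [Metric.mem_ball, Subtype.dist_eq, dist_comm, Real.dist_eq]
    rw [← Complex.ofReal_sub, Complex.norm_real] at h
    exact not_le.1 h
  have hg : SpectralMeasure.IsBddMeasurable g := by
    refine .of_le (C := ε⁻¹) (Measurable.indicator (by fun_prop) hUm.compl) fun s => ?_
    by_cases hs : s ∈ Uᶜ
    · simp only [g, Set.indicator_of_mem hs, norm_inv]
      exact inv_anti₀ hε (hdist s hs)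
    · simp only [g, Set.indicator_of_notMem hs, norm_zero]
      positivity
  have hgs : ∀ s : realSpectrum A, ((s₀ : ℝ) : ℂ) * g s - ((s : ℝ) : ℂ) * g s =
      Uᶜ.indicator (fun _ => (1 : ℂ)) s := by
    intro s
    by_cases hs : s ∈ Uᶜ
    · simp only [g, Set.indicator_of_mem hs, ← sub_mul]
      refine mul_inv_cancel₀ fun h => ?_
      have := hdist s hs
      rw [h, norm_zero] at this
      exact absurd this (not_le.2 hε)
    · simp only [g, Set.indicator_of_notMem hs, mul_zero, sub_zero]
  have hind : ∀ y : H, E.Maps (Uᶜ.indicator fun _ => (1 : ℂ)) y y := by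
    intro y
    have := SpectralMeasure.maps_proj (E := E) hUm.compl y
    rwa [hUc] at this
  refine s₀.2 ⟨E.bdd g, fun y => ?_, fun x => ?_⟩
  · have h1 := E.maps_bdd hg y
    have h2 : E.Maps (fun s => ((s : ℝ) : ℂ)) (E.bdd g y) (((s₀ : ℝ) : ℂ) • E.bdd g y - y) := by
      rw [h1.comp_iff hg.1 measurable_id_ofReal]
      convert (h1.const_mul hg.1 ((s₀ : ℝ) : ℂ)).sub (hg.1.const_mul _)
        (measurable_const.indicator hUm.compl) (hind y) using 1
      ext s
      rw [← hgs s]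
      ring
    obtain ⟨x, hx, hx'⟩ := A.mem_graph_iff.1 (hE.mem_graph_iff.2 h2)
    simp only at hx hx'
    refine ⟨hx ▸ x.2, ?_⟩
    have : (⟨E.bdd g y, hx ▸ x.2⟩ : A.domain) = x := Subtype.ext hx.symm
    rw [this, hx']
    simp
  · have h1 := hE.mem_graph_iff.1 (A.mem_graph x)
    have h2 := (h1.comp_iff measurable_id_ofReal hg.1).1 (E.maps_bdd hg _)
    have h3 := ((E.maps_bdd hg (x : H)).const_mul hg.1 ((s₀ : ℝ) : ℂ)).sub (hg.1.const_mul _)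
      (hg.1.mul measurable_id_ofReal) h2
    rw [map_sub, map_smul]
    refine h3.unique ?_
    convert hind (x : H) using 1
    ext s
    rw [← hgs s, mul_comm ((s : ℝ) : ℂ)]
    rfl

/-- Any nonzero vector in the range of `E` of the ball of radius `δ` about `s₀` will do. -/
theorem IsSpectralMeasureOf.exists_approx_eigenvector (hE : IsSpectralMeasureOf A E)
    (s₀ : realSpectrum A) {δ : ℝ} (hδ : 0 < δ) :
    ∃ u : A.domain, (u : H) ≠ 0 ∧ ‖A u - ((s₀ : ℝ) : ℂ) • (u : H)‖ ≤ δ * ‖(u : H)‖ := by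
  obtain ⟨u, hu0, hu⟩ := hE.exists_proj_eq_self (Metric.isOpen_ball (x := s₀) (ε := δ))
    (Metric.mem_ball_self hδ)
  set U := Metric.ball s₀ δ with hU
  have hUm : MeasurableSet U := Metric.isOpen_ball.measurableSet
  have h1 : E.Maps (U.indicator fun _ => (1 : ℂ)) u u := by
    have := SpectralMeasure.maps_proj (E := E) hUm u
    rwa [hu] at this
  let g : realSpectrum A → ℂ := fun s =>
    (((s : ℝ) : ℂ) - ((s₀ : ℝ) : ℂ)) * U.indicator (fun _ => (1 : ℂ)) s
  have hgm : Measurable g :=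
    (measurable_id_ofReal.sub measurable_const).mul (measurable_const.indicator hUm)
  have hg : ∀ s, ‖g s‖ ≤ δ := by
    intro s
    by_cases hs : s ∈ U
    · simp only [g, Set.indicator_of_mem hs, mul_one]
      rw [← Complex.ofReal_sub, Complex.norm_real]
      exact (Metric.mem_ball.1 hs).le
    · simp only [g, Set.indicator_of_notMem hs, mul_zero, norm_zero]
      exact hδ.le
  have hgb := SpectralMeasure.IsBddMeasurable.of_le hgm hg
  have h2 : E.Maps (fun s => ((s : ℝ) : ℂ)) u (E.bdd g u + ((s₀ : ℝ) : ℂ) • u) := by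
    rw [h1.comp_iff (measurable_const.indicator hUm) measurable_id_ofReal]
    convert (E.maps_bdd hgb u).add hgm ((measurable_const.indicator hUm).const_mul _)
      (h1.const_mul (measurable_const.indicator hUm) ((s₀ : ℝ) : ℂ)) using 1
    ext s
    simp only [g]
    ring
  obtain ⟨x, hx, hx'⟩ := A.mem_graph_iff.1 (hE.mem_graph_iff.2 h2)
  simp only at hx hx'
  refine ⟨x, hx ▸ hu0, ?_⟩
  rw [hx', hx, add_sub_cancel_right]
  exact E.norm_bdd_le hgm hδ.le hg u

theorem IsSpectralMeasureOf.isClosed_realSpectrum (hE : IsSpectralMeasureOf A E) :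
    IsClosed (realSpectrum A) := by
  refine isClosed_of_closure_subset fun t ht => ?_
  rintro ⟨R, -, hR⟩
  -- The error at `t` is at most `2δ`: `δ` from the approximate eigenvector and `δ` from `|t - s|`.
  -- This choice makes `‖R‖ · 2δ < 1`.
  set δ : ℝ := (2 * (‖R‖ + 1))⁻¹ with hδ
  have hδpos : 0 < δ := by positivity
  obtain ⟨s, hs, hst⟩ := Metric.mem_closure_iff.1 ht δ hδpos
  obtain ⟨u, hu0, hu⟩ := hE.exists_approx_eigenvector ⟨s, hs⟩ hδpos
  have hupos : 0 < ‖(u : H)‖ := norm_pos_iff.2 hu0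
  have h1 : ‖(t : ℂ) • (u : H) - A u‖ ≤ 2 * δ * ‖(u : H)‖ := by
    have : (t : ℂ) • (u : H) - A u = ((t : ℂ) - (s : ℂ)) • (u : H) - (A u - (s : ℂ) • (u : H)) := by
      rw [sub_smul]
      abel
    rw [this]
    refine (norm_sub_le _ _).trans ?_
    rw [norm_smul, ← Complex.ofReal_sub, Complex.norm_real]
    have hts : ‖t - s‖ ≤ δ := by
      rw [← dist_eq_norm]
      exact hst.le
    nlinarith [mul_le_mul_of_nonneg_right hts hupos.le]
  have h2 : ‖(u : H)‖ ≤ ‖R‖ * (2 * δ * ‖(u : H)‖) := by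
    conv_lhs => rw [← hR u]
    exact (R.le_opNorm _).trans (by gcongr)
  have h3 : ‖R‖ * (2 * δ) < 1 := by
    rw [hδ, mul_inv, ← mul_assoc, ← mul_assoc, mul_comm ‖R‖ 2, mul_assoc 2, mul_comm ‖R‖, ← mul_assoc,
      mul_inv_cancel₀ (by norm_num), one_mul, ← div_eq_mul_inv, div_lt_one (by positivity)]
    linarith
  nlinarith

/-- The constant of the quadratic form works: evaluate the form on approximate eigenvectors. -/
theorem IsSpectralMeasureOf.exists_lower_bound (hE : IsSpectralMeasureOf A E)
    (hpos : IsStrictlyPositive A) : ∃ c : ℝ, 0 < c ∧ ∀ s : realSpectrum A, c ≤ s := by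
  obtain ⟨c, hc, hcA⟩ := hpos
  refine ⟨c, hc, fun s => le_of_forall_pos_le_add fun δ hδ => ?_⟩
  obtain ⟨u, hu0, hu⟩ := hE.exists_approx_eigenvector s hδ
  have hupos : 0 < ‖(u : H)‖ := norm_pos_iff.2 hu0
  have h1 := hcA u
  have h2 : inner ℂ (u : H) (A u) = inner ℂ (u : H) (A u - ((s : ℝ) : ℂ) • (u : H)) +
      (((s : ℝ) * ‖(u : H)‖ ^ 2 : ℝ) : ℂ) := by
    rw [inner_sub_right, inner_smul_right, inner_self_eq_ofReal, Complex.ofReal_mul,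
      sub_add_cancel]
  have h3 : (inner ℂ (u : H) (A u - ((s : ℝ) : ℂ) • (u : H))).re ≤ ‖(u : H)‖ * (δ * ‖(u : H)‖) :=
    (Complex.re_le_norm _).trans ((norm_inner_le_norm _ _).trans (by gcongr))
  rw [h2, Complex.add_re, Complex.ofReal_re] at h1
  have h4 : c * ‖(u : H)‖ ^ 2 ≤ ((s : ℝ) + δ) * ‖(u : H)‖ ^ 2 := by nlinarith
  exact le_of_mul_le_mul_right h4 (by positivity)

end Support

/-! ### The roots of the symbol -/

section Roots

theorem eq_xiPlus_or_eq_xiMinus_iff {a s : ℝ} (hs : 0 < s) (ha : 0 ≤ a) (ξ : ℂ) :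
    (ξ = xiPlus a s ∨ ξ = xiMinus a s) ↔ ξ ^ 2 + ξ * a + s = 0 := by
  have hfac : (ξ - xiPlus a s) * (ξ - xiMinus a s) = ξ ^ 2 + ξ * a + s := by
    rw [xiPlus, xiMinus]
    split_ifs with h
    · have h1 : 0 ≤ a ^ 2 - 4 * s := by
        have := Real.sq_sqrt hs.le
        nlinarith [Real.sqrt_nonneg s]
      have h2 : ((√(a ^ 2 - 4 * s) : ℝ) : ℂ) ^ 2 = (a : ℂ) ^ 2 - 4 * s := by
        rw [← Complex.ofReal_pow, Real.sq_sqrt h1]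
        push_cast
        ring
      linear_combination (-1 / 4 : ℂ) * h2
    · have h1 : 0 ≤ 4 * s - a ^ 2 := by
        have := Real.sq_sqrt hs.le
        nlinarith [Real.sqrt_nonneg s]
      have h2 : ((√(4 * s - a ^ 2) : ℝ) : ℂ) ^ 2 = 4 * s - (a : ℂ) ^ 2 := by
        rw [← Complex.ofReal_pow, Real.sq_sqrt h1]
        push_cast
        ring
      linear_combination (1 / 4 : ℂ) * h2 - ((√(4 * s - a ^ 2) : ℝ) : ℂ) ^ 2 / 4 * Complex.I_sq
  rw [← hfac, mul_eq_zero, sub_eq_zero, sub_eq_zero]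

/-- The right-hand side is positive: `ξ + f(s) = 0` at a root would force `s = 0`. -/
theorem exists_lt_of_root {σ : Set ℝ} {f : σ → ℝ} {ξ : ℂ} {s : σ} (hs : (s : ℝ) ≠ 0)
    (h : ξ ^ 2 + ξ * f s + (s : ℝ) = 0) {ε : ℝ} (hε : 0 < ε) :
    ‖ξ ^ 2 + ξ * f s + (s : ℝ)‖ < ε * ‖ξ + f s‖ := by
  rw [h, norm_zero]
  refine mul_pos hε (norm_pos_iff.2 fun h0 => hs ?_)
  have : ((s : ℝ) : ℂ) = 0 := by linear_combination h - ξ * h0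
  exact_mod_cast this

/-- After division by `s_n` the left side tends to `|ξ l + 1| = 0` and the right side to `ε l > 0`.
-/
theorem exists_lt_of_limit {σ : Set ℝ} {f : σ → ℝ} {l : ℝ} (hl : 0 < l) {s : ℕ → σ}
    (hs : Tendsto (fun n => (s n : ℝ)) atTop atTop)
    (hfs : Tendsto (fun n => f (s n) / (s n : ℝ)) atTop (𝓝 l)) {ξ : ℂ} (hξ : ξ = -1 / (l : ℂ))
    {ε : ℝ} (hε : 0 < ε) : ∃ s : σ, ‖ξ ^ 2 + ξ * f s + (s : ℝ)‖ < ε * ‖ξ + f s‖ := by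
  have hl0 : (l : ℂ) ≠ 0 := Complex.ofReal_ne_zero.2 hl.ne'
  have hinv : Tendsto (fun n => (((s n : ℝ)⁻¹ : ℝ) : ℂ)) atTop (𝓝 0) := by
    have := (Complex.continuous_ofReal.tendsto 0).comp (tendsto_inv_atTop_zero.comp hs)
    rwa [Complex.ofReal_zero] at this
  have hr : Tendsto (fun n => ((f (s n) / (s n : ℝ) : ℝ) : ℂ)) atTop (𝓝 (l : ℂ)) :=
    (Complex.continuous_ofReal.tendsto l).comp hfs
  have h1 : Tendsto (fun n => ‖ξ ^ 2 * (((s n : ℝ)⁻¹ : ℝ) : ℂ) +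
      ξ * ((f (s n) / (s n : ℝ) : ℝ) : ℂ) + 1‖) atTop (𝓝 0) := by
    have := (((hinv.const_mul (ξ ^ 2)).add (hr.const_mul ξ)).add_const 1).norm
    have h0 : ξ ^ 2 * 0 + ξ * (l : ℂ) + 1 = 0 := by
      rw [hξ]
      field_simp
      ring
    rwa [h0, norm_zero] at this
  have h2 : Tendsto (fun n => ε * ‖ξ * (((s n : ℝ)⁻¹ : ℝ) : ℂ) +
      ((f (s n) / (s n : ℝ) : ℝ) : ℂ)‖) atTop (𝓝 (ε * l)) := by
    have := ((hinv.const_mul ξ).add hr).norm.const_mul ε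
    simpa [abs_of_pos hl] using this
  obtain ⟨n, hn, hn0⟩ := ((h1.eventually_lt h2 (by positivity)).and
    (hs.eventually_gt_atTop 0)).exists
  refine ⟨s n, ?_⟩
  have hsn : ((s n : ℝ) : ℂ) ≠ 0 := Complex.ofReal_ne_zero.2 hn0.ne'
  have e1 : ξ ^ 2 + ξ * f (s n) + (s n : ℝ) = ((s n : ℝ) : ℂ) * (ξ ^ 2 * (((s n : ℝ)⁻¹ : ℝ) : ℂ) +
      ξ * ((f (s n) / (s n : ℝ) : ℝ) : ℂ) + 1) := by
    push_cast
    field_simp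
  have e2 : ξ + f (s n) = ((s n : ℝ) : ℂ) * (ξ * (((s n : ℝ)⁻¹ : ℝ) : ℂ) +
      ((f (s n) / (s n : ℝ) : ℝ) : ℂ)) := by
    push_cast
    field_simp
  rw [e1, e2, norm_mul, norm_mul, mul_left_comm]
  exact mul_lt_mul_of_pos_left hn (norm_pos_iff.2 hsn)

theorem root_or_limit_of_forall_exists_lt {σ : Set ℝ} (hσ : IsClosed σ) {c : ℝ} (hc : 0 < c)
    (hcσ : ∀ s : σ, c ≤ s) {f : σ → ℝ} (hf : Continuous f) (hf0 : ∀ s, 0 ≤ f s) {ξ : ℂ}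
    (hξ : ξ ≠ 0) (h : ∀ ε > 0, ∃ s : σ, ‖ξ ^ 2 + ξ * f s + (s : ℝ)‖ < ε * ‖ξ + f s‖) :
    (∃ s : σ, ξ ^ 2 + ξ * f s + (s : ℝ) = 0) ∨
      ∃ l : ℝ, 0 < l ∧ (∃ s : ℕ → σ, Tendsto (fun n => (s n : ℝ)) atTop atTop ∧
        Tendsto (fun n => f (s n) / (s n : ℝ)) atTop (𝓝 l)) ∧ ξ = -1 / (l : ℂ) := by
  have hex : ∀ n : ℕ, ∃ s : σ, ‖ξ ^ 2 + ξ * f s + (s : ℝ)‖ < 1 / ((n : ℝ) + 1) * ‖ξ + f s‖ :=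
    fun n => h _ (by positivity)
  choose s hs using hex
  have hε : Tendsto (fun n : ℕ => 1 / ((n : ℝ) + 1)) atTop (𝓝 0) :=
    tendsto_one_div_add_atTop_nhds_zero_nat
  by_cases hinf : Tendsto (fun n => (s n : ℝ)) atTop atTop
  · right
    have hξpos : 0 < ‖ξ‖ := norm_pos_iff.2 hξ
    have hpos : ∀ n, 0 < (s n : ℝ) := fun n => hc.trans_le (hcσ _)
    have hinv : Tendsto (fun n => (s n : ℝ)⁻¹) atTop (𝓝 0) := tendsto_inv_atTop_zero.comp hinf
    set r : ℕ → ℝ := fun n => f (s n) / (s n : ℝ) with hr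
    have hr0 : ∀ n, 0 ≤ r n := fun n => div_nonneg (hf0 _) (hpos n).le
    have hdiv : ∀ n, ‖ξ * r n + 1‖ ≤
        1 / ((n : ℝ) + 1) * (‖ξ‖ * (s n : ℝ)⁻¹ + r n) + ‖ξ‖ ^ 2 * (s n : ℝ)⁻¹ := by
      intro n
      have hsn : ((s n : ℝ) : ℂ) ≠ 0 := Complex.ofReal_ne_zero.2 (hpos n).ne'
      have e1 : ξ * r n + 1 = (ξ ^ 2 + ξ * f (s n) + (s n : ℝ)) * (((s n : ℝ)⁻¹ : ℝ) : ℂ) -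
          ξ ^ 2 * (((s n : ℝ)⁻¹ : ℝ) : ℂ) := by
        simp only [hr]
        push_cast
        field_simp
        ring
      have e2 : ‖((((s n : ℝ)⁻¹ : ℝ)) : ℂ)‖ = (s n : ℝ)⁻¹ := by
        rw [Complex.norm_real, Real.norm_of_nonneg (inv_nonneg.2 (hpos n).le)]
      have e3 : ‖ξ + f (s n)‖ ≤ ‖ξ‖ + f (s n) := by
        refine (norm_add_le _ _).trans ?_
        rw [Complex.norm_real, Real.norm_of_nonneg (hf0 _)]
      have hi : 0 ≤ (s n : ℝ)⁻¹ := inv_nonneg.2 (hpos n).le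
      rw [e1]
      refine (norm_sub_le _ _).trans ?_
      rw [norm_mul, norm_mul, e2, norm_pow]
      refine add_le_add_left ?_ _
      calc ‖ξ ^ 2 + ξ * f (s n) + (s n : ℝ)‖ * (s n : ℝ)⁻¹
          ≤ (1 / ((n : ℝ) + 1) * (‖ξ‖ + f (s n))) * (s n : ℝ)⁻¹ := by
            gcongr
            exact (hs n).le.trans (by gcongr)
        _ = 1 / ((n : ℝ) + 1) * (‖ξ‖ * (s n : ℝ)⁻¹ + r n) := by
            simp only [hr]
            ring
    -- Once `1/(n+1) ≤ ‖ξ‖/2`, the term `r n/(n+1)` of `hdiv` is absorbed by half of `‖ξ‖ r n`; the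
    -- bracket bounds what is left.
    set K : ℝ := 2 / ‖ξ‖ * (1 + ‖ξ‖ ^ 2 + ‖ξ‖) with hK
    have hbound : ∀ᶠ n in atTop, r n ≤ K := by
      filter_upwards [hε.eventually_le_const (show (0 : ℝ) < ‖ξ‖ / 2 by positivity),
        hε.eventually_le_const one_pos, hinv.eventually_le_const one_pos] with n h1 h2 h3
      have h4 : ‖ξ‖ * r n ≤ ‖ξ * r n + 1‖ + 1 := by
        have := norm_sub_le (ξ * r n + 1) 1
        rw [add_sub_cancel_right, norm_mul, Complex.norm_real, Real.norm_of_nonneg (hr0 n),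
          norm_one] at this
        exact this
      have h5 := hdiv n
      have hi : 0 ≤ (s n : ℝ)⁻¹ := inv_nonneg.2 (hpos n).le
      have h6 : 1 / ((n : ℝ) + 1) * r n ≤ ‖ξ‖ / 2 * r n := mul_le_mul_of_nonneg_right h1 (hr0 n)
      have h7 : 1 / ((n : ℝ) + 1) * (‖ξ‖ * (s n : ℝ)⁻¹) ≤ 1 * (‖ξ‖ * 1) := by gcongr
      have h8 : ‖ξ‖ ^ 2 * (s n : ℝ)⁻¹ ≤ ‖ξ‖ ^ 2 * 1 := by gcongr
      rw [hK, div_mul_eq_mul_div, le_div_iff₀ hξpos]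
      nlinarith
    have hlim : Tendsto (fun n => ξ * (r n : ℂ) + 1) atTop (𝓝 0) := by
      rw [tendsto_zero_iff_norm_tendsto_zero]
      have hup : Tendsto (fun n : ℕ => 1 / ((n : ℝ) + 1) * (‖ξ‖ * (s n : ℝ)⁻¹ + K) +
          ‖ξ‖ ^ 2 * (s n : ℝ)⁻¹) atTop (𝓝 0) := by
        have := (hε.mul ((hinv.const_mul ‖ξ‖).add_const K)).add (hinv.const_mul (‖ξ‖ ^ 2))
        simpa using this
      refine tendsto_of_tendsto_of_tendsto_of_le_of_le' tendsto_const_nhds hup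
        (Eventually.of_forall fun _ => norm_nonneg _) ?_
      filter_upwards [hbound] with n hn
      refine (hdiv n).trans ?_
      gcongr
    have hrL : Tendsto (fun n => (r n : ℂ)) atTop (𝓝 (-1 / ξ)) := by
      have := (hlim.sub_const 1).div_const ξ
      rw [zero_sub] at this
      refine this.congr fun n => ?_
      rw [add_sub_cancel_right, mul_div_cancel_left₀ _ hξ]
    have hre : Tendsto r atTop (𝓝 (-1 / ξ).re) :=
      (Complex.continuous_re.tendsto _).comp hrL
    have him : (-1 / ξ).im = 0 :=
      tendsto_nhds_unique ((Complex.continuous_im.tendsto _).comp hrL)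
        (by simp [Function.comp_def])
    have hL : -1 / ξ = (((-1 / ξ).re : ℝ) : ℂ) := Complex.ext (by simp) (by simpa using him)
    have hne : (-1 / ξ).re ≠ 0 := by
      intro h0
      rw [h0, Complex.ofReal_zero] at hL
      exact div_ne_zero (by norm_num) hξ hL
    have hnonneg : 0 ≤ (-1 / ξ).re := ge_of_tendsto' hre hr0
    refine ⟨(-1 / ξ).re, lt_of_le_of_ne hnonneg hne.symm, ⟨s, hinf, hre⟩, ?_⟩
    rw [← hL]
    field_simp
  · left
    -- A subsequence stays in `[c, b]`; along a convergent one `ξ + f` stays bounded, so the symbol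
    -- tends to `0`.
    obtain ⟨b, hb⟩ : ∃ b : ℝ, ∃ᶠ n in atTop, (s n : ℝ) < b := by
      rw [tendsto_atTop] at hinf
      push Not at hinf
      simpa using hinf
    obtain ⟨φ, hφ, hφb⟩ := extraction_of_frequently_atTop hb
    obtain ⟨t, -, ψ, hψ, ht⟩ := (isCompact_Icc (a := c) (b := b)).tendsto_subseq
      (x := fun n => (s (φ n) : ℝ)) fun n => ⟨hcσ _, (hφb n).le⟩
    have htσ : t ∈ σ := hσ.mem_of_tendsto ht (Eventually.of_forall fun n => (s (φ (ψ n))).2)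
    have hconv : Tendsto (fun n => s (φ (ψ n))) atTop (𝓝 ⟨t, htσ⟩) :=
      tendsto_subtype_rng.2 ht
    refine ⟨⟨t, htσ⟩, ?_⟩
    have hg : Continuous fun x : σ => ‖ξ ^ 2 + ξ * f x + ((x : ℝ) : ℂ)‖ := by fun_prop
    have hk : Continuous fun x : σ => ‖ξ + f x‖ := by fun_prop
    have h1 := (hg.tendsto _).comp hconv
    have h2 := ((hε.comp (hφ.comp hψ).tendsto_atTop)).mul ((hk.tendsto _).comp hconv)
    rw [zero_mul] at h2
    have h3 := le_of_tendsto_of_tendsto' h1 h2 fun n => (hs _).le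
    exact norm_le_zero_iff.1 h3

end Roots

end

section

/-! ### Truncation to sets where `s` and `f` are bounded -/

theorem measurable_ofReal_comp {σ : Set ℝ} {f : σ → ℝ} (hf : Continuous f) :
    Measurable fun s => (f s : ℂ) :=
  Complex.measurable_ofReal.comp hf.measurable

/-- The bounded pieces of the spectrum on which `f` is bounded. -/
def levelSet {σ : Set ℝ} (f : σ → ℝ) (n : ℕ) : Set σ := {s | |(s : ℝ)| ≤ n ∧ |f s| ≤ n}

theorem measurableSet_levelSet {σ : Set ℝ} {f : σ → ℝ} (hf : Continuous f) (n : ℕ) :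
    MeasurableSet (levelSet f n) :=
  ((isClosed_le (f := fun s : σ => |(s : ℝ)|) (by fun_prop) continuous_const).inter
    (isClosed_le (f := fun s => |f s|) (by fun_prop) continuous_const)).measurableSet

theorem isBddMeasurable_levelSet {σ : Set ℝ} {f : σ → ℝ} (hf : Continuous f) (n : ℕ)
    {g : σ → ℝ} (hg : Continuous g) (hgn : ∀ s ∈ levelSet f n, |g s| ≤ n) :
    SpectralMeasure.IsBddMeasurable fun s =>
      (g s : ℂ) * (levelSet f n).indicator (fun _ => (1 : ℂ)) s := by
  refine .of_le (C := n) ((Complex.measurable_ofReal.comp hg.measurable).mul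
    (measurable_const.indicator (measurableSet_levelSet hf n))) fun s => ?_
  by_cases hs : s ∈ levelSet f n
  · simpa [hs] using hgn s hs
  · simp [hs]

variable {H : Type*} [NormedAddCommGroup H] [InnerProductSpace ℂ H] [CompleteSpace H]

/-! ### The generator in terms of the spectral measure -/

section Generator

variable {A : H →ₗ.[ℂ] H} {f : realSpectrum A → ℝ} {E : SpectralMeasure (realSpectrum A) H}

/-- The spectral measure `E` of `A` is the one that defines the functional calculus of `A`. -/
structure IsCalculusMeasure (A : H →ₗ.[ℂ] H) (E : SpectralMeasure (realSpectrum A) H) : Prop where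
  isSpectralMeasureOf : IsSpectralMeasureOf A E
  functionalCalculus_eq : ∀ φ, functionalCalculus A φ = E.integral φ

/-- Taking the very measure chosen in `functionalCalculus` makes uniqueness of the spectral measure
unnecessary. -/
theorem exists_isCalculusMeasure (hA : IsSelfAdjoint A) (hpos : IsStrictlyPositive A) :
    ∃ E : SpectralMeasure (realSpectrum A) H, IsCalculusMeasure A E := by
  have h := exists_isSpectralMeasureOf hA hpos
  exact ⟨h.choose, h.choose_spec, fun φ => by rw [functionalCalculus, dif_pos h]⟩

theorem IsCalculusMeasure.mem_graph_realCalculus_iff (hE : IsCalculusMeasure A E)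
    {g : realSpectrum A → ℝ} (hg : Continuous g) {u w : H} :
    (u, w) ∈ (realCalculus A g).graph ↔ E.Maps (fun s => (g s : ℂ)) u w := by
  rw [realCalculus, hE.functionalCalculus_eq]
  exact SpectralMeasure.mem_graph_integral_iff (Complex.measurable_ofReal.comp hg.measurable)

theorem isWeakSum_iff (hE : IsCalculusMeasure A E) (hf : Continuous f) {u v h : H} :
    IsWeakSum A f u v h ↔ ∀ w y z, E.Maps (fun s => ((s : ℝ) : ℂ)) w y →
      E.Maps (fun s => (f s : ℂ)) w z → inner ℂ u y + inner ℂ v z = inner ℂ h w := by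
  constructor
  · intro hW w y z hy hz
    rw [← hE.isSpectralMeasureOf.mem_graph_iff] at hy
    rw [← hE.mem_graph_realCalculus_iff hf] at hz
    have h1 := hW w (A.mem_domain_of_mem_graph hy) ((realCalculus A f).mem_domain_of_mem_graph hz)
    obtain ⟨a, ha, ha'⟩ := A.mem_graph_iff.1 hy
    obtain ⟨b, hb, hb'⟩ := (realCalculus A f).mem_graph_iff.1 hz
    simp only at ha ha' hb hb'
    rw [show (⟨w, A.mem_domain_of_mem_graph hy⟩ : A.domain) = a from Subtype.ext ha.symm, ha',
      show (⟨w, (realCalculus A f).mem_domain_of_mem_graph hz⟩ : (realCalculus A f).domain) = b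
        from Subtype.ext hb.symm, hb'] at h1
    exact h1
  · intro hW w hA hf'
    exact hW w _ _ (hE.isSpectralMeasureOf.mem_graph_iff.1 (A.mem_graph ⟨w, hA⟩))
      ((hE.mem_graph_realCalculus_iff hf).1 ((realCalculus A f).mem_graph ⟨w, hf'⟩))

theorem IsWeakSum.add {u v h u' v' h' : H} (H₁ : IsWeakSum A f u v h)
    (H₂ : IsWeakSum A f u' v' h') : IsWeakSum A f (u + u') (v + v') (h + h') := by
  intro w hA hf
  rw [inner_add_left, inner_add_left, inner_add_left, ← H₁ w hA hf, ← H₂ w hA hf]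
  ring

/-- Weak sums from identities between multipliers. -/
theorem isWeakSum_bdd (hE : IsCalculusMeasure A E) (hf : Continuous f) {a b k : realSpectrum A → ℂ}
    (ha : SpectralMeasure.IsBddMeasurable a) (hb : SpectralMeasure.IsBddMeasurable b)
    (hk : SpectralMeasure.IsBddMeasurable k) (h : ∀ s, a s * (s : ℝ) + b s * f s = k s) (x : H) :
    IsWeakSum A f (E.bdd a x) (E.bdd b x) (E.bdd k x) := by
  rw [isWeakSum_iff hE hf]
  intro w y z hy hz
  rw [E.inner_bdd_left ha, E.inner_bdd_left hb, E.inner_bdd_left hk, ← inner_add_right]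
  congr 1
  have h1 := (hy.comp_iff measurable_id_ofReal ha.conj.1).1 (E.maps_bdd ha.conj y)
  have h2 := (hz.comp_iff (measurable_ofReal_comp hf) hb.conj.1).1 (E.maps_bdd hb.conj z)
  have h3 := h1.add (ha.conj.1.mul measurable_id_ofReal)
    (hb.conj.1.mul (measurable_ofReal_comp hf)) h2
  refine h3.unique ?_
  convert E.maps_bdd hk.conj w using 1
  ext s
  rw [← h s]
  simp

theorem eq_zero_of_forall_proj_levelSet (hf : Continuous f) {u : H}
    (h : ∀ n, E.proj (levelSet f n) u = 0) : u = 0 := by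
  have hU : ⋃ n, levelSet f n = Set.univ := by
    refine Set.eq_univ_of_forall fun s => Set.mem_iUnion.2 ?_
    obtain ⟨n, hn⟩ := exists_nat_ge (max |(s : ℝ)| |f s|)
    exact ⟨n, (le_max_left _ _).trans hn, (le_max_right _ _).trans hn⟩
  have h0 : E.diag u Set.univ = 0 := by
    rw [← hU, measure_iUnion_null_iff]
    intro n
    rw [E.diag_apply u (measurableSet_levelSet hf n), h n]
    simp
  rw [E.diag_univ, ENNReal.ofReal_eq_zero] at h0
  have : ‖u‖ ^ 2 = 0 := le_antisymm h0 (by positivity)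
  simpa using this

/-- A weak sum, restricted to a bounded piece of the spectrum. -/
theorem IsWeakSum.inner_levelSet (hE : IsCalculusMeasure A E) (hf : Continuous f) {u v h : H}
    (hW : IsWeakSum A f u v h) (n : ℕ) (z : H) :
    inner ℂ u (E.bdd (fun s => ((s : ℝ) : ℂ) * (levelSet f n).indicator (fun _ => (1 : ℂ)) s) z) +
      inner ℂ v (E.bdd (fun s => (f s : ℂ) * (levelSet f n).indicator (fun _ => (1 : ℂ)) s) z) =
      inner ℂ h (E.proj (levelSet f n) z) := by
  have hm := measurableSet_levelSet hf n
  have h1 := SpectralMeasure.maps_proj (E := E) hm z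
  refine (isWeakSum_iff hE hf).1 hW _ _ _ ?_ ?_
  · rw [h1.comp_iff (measurable_const.indicator hm) measurable_id_ofReal]
    exact E.maps_bdd (isBddMeasurable_levelSet hf n (g := fun s => (s : ℝ)) (by fun_prop)
      fun s hs => hs.1) z
  · rw [h1.comp_iff (measurable_const.indicator hm) (measurable_ofReal_comp hf)]
    exact E.maps_bdd (isBddMeasurable_levelSet hf n hf fun s hs => hs.2) z

/-- The truncations `E(ω_n)h` lie in `D(A) ∩ D(f(A))`; tested against them, the identity reads
`‖E(ω_n)h‖² = 0`. -/
theorem IsWeakSum.eq_zero (hE : IsCalculusMeasure A E) (hf : Continuous f) {h : H}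
    (hW : IsWeakSum A f 0 0 h) : h = 0 := by
  refine eq_zero_of_forall_proj_levelSet (E := E) hf fun n => ?_
  have h1 := hW.inner_levelSet hE hf n h
  rw [inner_zero_left, inner_zero_left, add_zero, E.inner_proj_self _ (measurableSet_levelSet hf n)]
    at h1
  have : ‖E.proj (levelSet f n) h‖ ^ 2 = 0 := by exact_mod_cast h1.symm
  simpa using this

/-- The kernel of `ξ - 𝔸` is trivial if the symbol does not vanish. -/
theorem IsWeakSum.eq_zero_of_eigen (hE : IsCalculusMeasure A E) (hf : Continuous f) {u : H} {ξ : ℂ}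
    (hp : SpectralMeasure.IsBddMeasurable fun s : realSpectrum A =>
      (ξ ^ 2 + ξ * f s + (s : ℝ))⁻¹)
    (hp0 : ∀ s : realSpectrum A, ξ ^ 2 + ξ * f s + (s : ℝ) ≠ 0)
    (hW : IsWeakSum A f u (ξ • u) (-(ξ • ξ • u))) : u = 0 := by
  refine eq_zero_of_forall_proj_levelSet (E := E) hf fun n => ?_
  have hm := measurableSet_levelSet hf n
  have hs1 := isBddMeasurable_levelSet hf n (g := fun s => (s : ℝ)) (by fun_prop) fun s hs => hs.1
  have hf1 := isBddMeasurable_levelSet hf n hf fun s hs => hs.2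
  -- With this test vector all multipliers combine to `p̄ · p̄⁻¹` on the level set, where `p` is the
  -- symbol, and the identity becomes `‖E(ω_n)u‖² = 0`.
  have h1 := hW.inner_levelSet hE hf n
    (E.bdd (fun s => starRingEnd ℂ (ξ ^ 2 + ξ * f s + (s : ℝ))⁻¹) u)
  have hind := SpectralMeasure.IsBddMeasurable.indicator hm
  rw [inner_smul_left, inner_neg_left, inner_smul_left, inner_smul_left, ← inner_smul_right,
    ← E.bdd_indicator hm, E.bdd_bdd hp.conj hs1, E.bdd_bdd hp.conj hf1, E.bdd_bdd hp.conj hind,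
    ← sub_eq_zero, sub_neg_eq_add, ← inner_smul_right, ← inner_smul_right, ← inner_add_right,
    ← inner_add_right, ← E.bdd_const_mul (hf1.mul hp.conj), ← E.bdd_const_mul (hind.mul hp.conj),
    ← E.bdd_const_mul ((SpectralMeasure.IsBddMeasurable.const _).mul (hind.mul hp.conj)),
    ← E.bdd_add (hs1.mul hp.conj) (.mul (.const _) (hf1.mul hp.conj)),
    ← E.bdd_add (.add (hs1.mul hp.conj) (.mul (.const _) (hf1.mul hp.conj)))
      (.mul (.const _) (.mul (.const _) (hind.mul hp.conj)))] at h1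
  have h2 : (fun s : realSpectrum A => (((s : ℝ) : ℂ) * (levelSet f n).indicator (fun _ => (1 : ℂ)) s *
      starRingEnd ℂ (ξ ^ 2 + ξ * f s + (s : ℝ))⁻¹ + starRingEnd ℂ ξ * ((f s : ℂ) *
      (levelSet f n).indicator (fun _ => (1 : ℂ)) s *
      starRingEnd ℂ (ξ ^ 2 + ξ * f s + (s : ℝ))⁻¹)) + starRingEnd ℂ ξ * (starRingEnd ℂ ξ *
      ((levelSet f n).indicator (fun _ => (1 : ℂ)) s *
      starRingEnd ℂ (ξ ^ 2 + ξ * f s + (s : ℝ))⁻¹))) =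
      (levelSet f n).indicator (fun _ => (1 : ℂ)) := by
    ext s
    have h0 : starRingEnd ℂ (ξ ^ 2 + ξ * f s + (s : ℝ)) ≠ 0 := (map_ne_zero _).2 (hp0 s)
    by_cases hs : s ∈ levelSet f n
    · simp only [Set.indicator_of_mem hs, mul_one, one_mul, map_inv₀]
      rw [← mul_assoc, ← mul_assoc, ← add_mul, ← add_mul, mul_inv_eq_one₀ h0]
      simp
      ring
    · simp only [Set.indicator_of_notMem hs, mul_zero, zero_mul, add_zero]
  rw [h2, E.bdd_indicator hm, E.inner_proj_self _ hm] at h1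
  have : ‖E.proj (levelSet f n) u‖ ^ 2 = 0 := by exact_mod_cast h1
  simpa using this

end Generator

end

section

/-! ### The resolvent set in terms of the graph -/

section ResolventGraph

variable {F : Type*} [SeminormedAddCommGroup F] [NormedSpace ℂ F] {T : F →ₗ.[ℂ] F} {ξ : ℂ}

theorem mem_resolventSet_of_graph (R : F →L[ℂ] F) (hR : ∀ y, (R y, ξ • R y - y) ∈ T.graph)
    (hker : ∀ x, (x, ξ • x) ∈ T.graph → x = 0) : ξ ∈ resolventSet T := by
  refine ⟨R, fun y => ?_, fun x => ?_⟩
  · obtain ⟨a, ha, ha'⟩ := T.mem_graph_iff.1 (hR y)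
    simp only at ha ha'
    refine ⟨ha ▸ a.2, ?_⟩
    rw [show (⟨R y, ha ▸ a.2⟩ : T.domain) = a from Subtype.ext ha.symm, ha', sub_sub_cancel]
  · have h := T.graph.sub_mem (T.mem_graph x) (hR (ξ • (x : F) - T x))
    rw [Prod.mk_sub_mk] at h
    refine (sub_eq_zero.1 (hker _ ?_)).symm
    convert h using 2
    rw [smul_sub]
    abel

theorem exists_bound_of_mem_resolventSet (h : ξ ∈ resolventSet T) :
    ∃ C : ℝ, 0 < C ∧ ∀ x z, (x, z) ∈ T.graph → ‖x‖ ≤ C * ‖ξ • x - z‖ := by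
  obtain ⟨R, -, hR⟩ := h
  refine ⟨‖R‖ + 1, by positivity, fun x z hxz => ?_⟩
  obtain ⟨a, ha, ha'⟩ := T.mem_graph_iff.1 hxz
  simp only at ha ha'
  have h1 := hR a
  rw [ha, ha'] at h1
  calc ‖x‖ = ‖R (ξ • x - z)‖ := by rw [h1]
    _ ≤ ‖R‖ * ‖ξ • x - z‖ := R.le_opNorm _
    _ ≤ (‖R‖ + 1) * ‖ξ • x - z‖ := by gcongr; linarith

end ResolventGraph

variable {H : Type*} [NormedAddCommGroup H] [InnerProductSpace ℂ H] [CompleteSpace H]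
  {A : H →ₗ.[ℂ] H} {f : realSpectrum A → ℝ} {E : SpectralMeasure (realSpectrum A) H}

/-! ### The space `H¹` -/

namespace HOne

variable (A) in
/-- The operator `A^{1/2}` on `H¹`, which is isometric. -/
def sqrt : HOne A →ₗᵢ[ℂ] H where
  toLinearMap := (sqrtOp A).toFun
  norm_map' _ := rfl

theorem incl_injective : Function.Injective (incl A) := Subtype.val_injective

theorem maps_incl_iff (hE : IsCalculusMeasure A E) {u w : H} :
    E.Maps (fun s => ((√(s : ℝ) : ℝ) : ℂ)) u w ↔ ∃ x : HOne A, incl A x = u ∧ sqrt A x = w := by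
  rw [← hE.mem_graph_realCalculus_iff (g := fun s => √(s : ℝ)) (by fun_prop)]
  exact (sqrtOp A).mem_graph_iff

theorem isBddMeasurable_inv_sqrt {σ : Set ℝ} {c : ℝ} (hc : 0 < c) (hcσ : ∀ s : σ, c ≤ s) :
    SpectralMeasure.IsBddMeasurable fun s : σ => ((√(s : ℝ) : ℝ) : ℂ)⁻¹ := by
  refine .of_le (C := (√c)⁻¹) (by fun_prop) fun s => ?_
  rw [norm_inv, Complex.norm_real, Real.norm_of_nonneg (Real.sqrt_nonneg _)]
  exact inv_anti₀ (Real.sqrt_pos.2 hc) (Real.sqrt_le_sqrt (hcσ s))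

theorem ofReal_sqrt_ne_zero {s : ℝ} (hs : 0 < s) : ((√s : ℝ) : ℂ) ≠ 0 :=
  Complex.ofReal_ne_zero.2 (Real.sqrt_pos.2 hs).ne'

theorem incl_eq_bdd (hE : IsCalculusMeasure A E) {c : ℝ} (hc : 0 < c)
    (hcσ : ∀ s : realSpectrum A, c ≤ s) (x : HOne A) :
    incl A x = E.bdd (fun s => ((√(s : ℝ) : ℝ) : ℂ)⁻¹) (sqrt A x) := by
  have hb := isBddMeasurable_inv_sqrt hc hcσ
  have h1 := (maps_incl_iff hE).2 ⟨x, rfl, rfl⟩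
  have h2 := (h1.comp_iff (by fun_prop) hb.1).1 (E.maps_bdd hb _)
  have h3 := E.maps_bdd (.const 1) (incl A x)
  rw [E.bdd_one] at h3
  refine h3.unique ?_
  convert h2 using 1
  ext s
  rw [inv_mul_cancel₀ (ofReal_sqrt_ne_zero (hc.trans_le (hcσ s)))]

theorem exists_sqrt_eq (hE : IsCalculusMeasure A E) {c : ℝ} (hc : 0 < c)
    (hcσ : ∀ s : realSpectrum A, c ≤ s) (w : H) : ∃ x : HOne A, sqrt A x = w := by
  have hb := isBddMeasurable_inv_sqrt hc hcσ
  have h1 := E.maps_bdd hb w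
  have h3 := E.maps_bdd (.const 1) w
  rw [E.bdd_one] at h3
  have h2 : E.Maps (fun s => ((√(s : ℝ) : ℝ) : ℂ))
      (E.bdd (fun s => ((√(s : ℝ) : ℝ) : ℂ)⁻¹) w) w := by
    rw [h1.comp_iff hb.1 (by fun_prop)]
    convert h3 using 1
    ext s
    rw [mul_inv_cancel₀ (ofReal_sqrt_ne_zero (hc.trans_le (hcσ s)))]
  obtain ⟨x, -, hx⟩ := (maps_incl_iff hE).1 h2
  exact ⟨x, hx⟩

theorem sqrt_injective (hE : IsCalculusMeasure A E) {c : ℝ} (hc : 0 < c)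
    (hcσ : ∀ s : realSpectrum A, c ≤ s) : Function.Injective (sqrt A) := fun x y h =>
  incl_injective (by rw [incl_eq_bdd hE hc hcσ, h, ← incl_eq_bdd hE hc hcσ])

/-- The inverse of `A^{1/2}` as an isometry of `H` onto `H¹`. -/
theorem exists_isometry (hE : IsCalculusMeasure A E) {c : ℝ} (hc : 0 < c)
    (hcσ : ∀ s : realSpectrum A, c ≤ s) : ∃ J : H →ₗᵢ[ℂ] HOne A, ∀ w, sqrt A (J w) = w := by
  choose j hj using exists_sqrt_eq hE hc hcσ
  have hinj := sqrt_injective hE hc hcσ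
  exact ⟨{ toFun := j
           map_add' := fun x y => hinj (by rw [map_add, hj, hj, hj])
           map_smul' := fun a x => hinj (by rw [RingHom.id_apply, map_smul, hj, hj])
           norm_map' := fun x => by
             rw [← (sqrt A).norm_map]
             exact congrArg norm (hj x) }, hj⟩

end HOne

/-! ### The spectrum of the generator -/

section GeneratorSpectrum

/-- The graph of `toLinearPMap` is the given subspace only if that has no nonzero vertical vector;
uniqueness of the weak sum provides this. -/
theorem graph_generator (hE : IsCalculusMeasure A E) (hf : Continuous f) :
    (generator A f).graph = generatorGraph A f := by
  refine Submodule.toLinearPMap_graph_eq _ ?_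
  rintro ⟨x, y⟩ ⟨h1, h2⟩ (rfl : x = 0)
  simp only [WithLp.zero_fst, WithLp.zero_snd, map_zero] at h1 h2
  have h3 : y.fst = 0 := HOne.incl_injective (by rw [h1, map_zero])
  have h4 : y.snd = 0 := neg_eq_zero.1 (h2.eq_zero hE hf)
  exact WithLp.ofLp_injective 2 (Prod.ext h3 h4)

/-- From `s = p - ξ (ξ + f)`, where `p` is the symbol. -/
theorem norm_symbol_bounds {σ : Set ℝ} {f : σ → ℝ} {c : ℝ} (hc : 0 < c) (hcσ : ∀ s : σ, c ≤ s) {ξ : ℂ}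
    {ε : ℝ} (hε : 0 < ε) (h : ∀ s, ε * ‖ξ + f s‖ ≤ ‖ξ ^ 2 + ξ * f s + (s : ℝ)‖) (s : σ) :
    (s : ℝ) ≤ (1 + ‖ξ‖ * ε⁻¹) * ‖ξ ^ 2 + ξ * f s + (s : ℝ)‖ := by
  have h1 : ‖ξ + f s‖ ≤ ε⁻¹ * ‖ξ ^ 2 + ξ * f s + (s : ℝ)‖ := by
    rw [inv_mul_eq_div, le_div_iff₀ hε, mul_comm]
    exact h s
  have h2 : ((s : ℝ) : ℂ) = (ξ ^ 2 + ξ * f s + (s : ℝ)) - ξ * (ξ + f s) := by ring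
  have h3 : (s : ℝ) = ‖((s : ℝ) : ℂ)‖ := by
    rw [Complex.norm_real, Real.norm_of_nonneg (hc.le.trans (hcσ s))]
  calc (s : ℝ) = ‖(ξ ^ 2 + ξ * f s + (s : ℝ)) - ξ * (ξ + f s)‖ := by rw [← h2, ← h3]
    _ ≤ ‖ξ ^ 2 + ξ * f s + (s : ℝ)‖ + ‖ξ‖ * ‖ξ + f s‖ := by
      rw [← norm_mul]
      exact norm_sub_le _ _
    _ ≤ ‖ξ ^ 2 + ξ * f s + (s : ℝ)‖ + ‖ξ‖ * (ε⁻¹ * ‖ξ ^ 2 + ξ * f s + (s : ℝ)‖) := by gcongr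
    _ = _ := by ring

/-- If `|ξ + f| ≤ C |ξ² + ξ f + s|` on `σ(A)` then `ξ` is in the resolvent set of the generator. -/
theorem mem_resolventSet_generator (hE : IsCalculusMeasure A E) {c : ℝ} (hc : 0 < c)
    (hcσ : ∀ s : realSpectrum A, c ≤ s) (hf : Continuous f) {ξ : ℂ} {ε : ℝ} (hε : 0 < ε)
    (h : ∀ s, ε * ‖ξ + f s‖ ≤ ‖ξ ^ 2 + ξ * f s + (s : ℝ)‖) :
    ξ ∈ resolventSet (generator A f) := by
  obtain ⟨J, hJ⟩ := HOne.exists_isometry hE hc hcσ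
  have hpos : ∀ s : realSpectrum A, 0 < (s : ℝ) := fun s => hc.trans_le (hcσ s)
  set p : realSpectrum A → ℂ := fun s => ξ ^ 2 + ξ * f s + (s : ℝ) with hp
  set K : ℝ := 1 + ‖ξ‖ * ε⁻¹ with hK
  have hKpos : 0 < K := by positivity
  have hsK : ∀ s : realSpectrum A, (s : ℝ) ≤ K * ‖p s‖ := norm_symbol_bounds hc hcσ hε h
  have hppos : ∀ s, 0 < ‖p s‖ := fun s => pos_of_mul_pos_right ((hpos s).trans_le (hsK s)) hKpos.le
  have hp0 : ∀ s, p s ≠ 0 := fun s => norm_pos_iff.1 (hppos s)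
  have hq0 : ∀ s : realSpectrum A, ((√(s : ℝ) : ℝ) : ℂ) ≠ 0 := fun s =>
    HOne.ofReal_sqrt_ne_zero (hpos s)
  have hq2 : ∀ s : realSpectrum A, ((s : ℝ) : ℂ) = ((√(s : ℝ) : ℝ) : ℂ) ^ 2 := fun s => by
    rw [← Complex.ofReal_pow, Real.sq_sqrt (hpos s).le]
  have hfm := measurable_ofReal_comp hf
  have hpm : Measurable p := by fun_prop
  have hinv : SpectralMeasure.IsBddMeasurable fun s => (p s)⁻¹ := by
    refine .of_le (C := K / c) hpm.inv fun s => ?_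
    rw [norm_inv, inv_le_comm₀ (hppos s) (by positivity), inv_div, div_le_iff₀ hKpos, mul_comm]
    exact (hcσ s).trans (hsK s)
  have hdiv : SpectralMeasure.IsBddMeasurable fun s : realSpectrum A => ((s : ℝ) : ℂ) * (p s)⁻¹ := by
    refine .of_le (C := K) (by fun_prop) fun s => ?_
    rw [norm_mul, norm_inv, ← div_eq_mul_inv, div_le_iff₀ (hppos s), Complex.norm_real,
      Real.norm_of_nonneg (hpos s).le]
    exact hsK s
  have hρ := HOne.isBddMeasurable_inv_sqrt hc hcσ
  have ha : SpectralMeasure.IsBddMeasurable fun s => (ξ + f s) * (p s)⁻¹ := by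
    refine .of_le (C := ε⁻¹) (by fun_prop) fun s => ?_
    rw [norm_mul, norm_inv, ← div_eq_mul_inv, div_le_iff₀ (hppos s), inv_mul_eq_div,
      le_div_iff₀ hε, mul_comm]
    exact h s
  -- `√s/p = s^{-1/2} · (s/p)`.
  have hb : SpectralMeasure.IsBddMeasurable fun s : realSpectrum A =>
      ((√(s : ℝ) : ℝ) : ℂ) * (p s)⁻¹ := by
    convert hρ.mul hdiv using 1
    ext s
    rw [hq2, pow_two, ← mul_assoc, ← mul_assoc, inv_mul_cancel₀ (hq0 s), one_mul]
  -- The resolvent matrix is `[[a, b], [-b, g]]`; `ρ` represents the inclusion of `H¹` in `H` once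
  -- `H¹` is identified with `H`.
  set a : realSpectrum A → ℂ := fun s => (ξ + f s) * (p s)⁻¹ with ha'
  set b : realSpectrum A → ℂ := fun s => ((√(s : ℝ) : ℝ) : ℂ) * (p s)⁻¹ with hb'
  set ρ : realSpectrum A → ℂ := fun s => ((√(s : ℝ) : ℝ) : ℂ)⁻¹ with hρ'
  set g : realSpectrum A → ℂ := fun s => ξ * (p s)⁻¹ with hg'
  have hg : SpectralMeasure.IsBddMeasurable g := .mul (.const ξ) hinv
  have hnb : SpectralMeasure.IsBddMeasurable fun s => -1 * b s := .mul (.const _) hb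
  have hincl : ∀ w, HOne.incl A (J w) = E.bdd ρ w := fun w => by
    rw [HOne.incl_eq_bdd hE hc hcσ, hJ]
  let S : PhaseSpace A →L[ℂ] H := (HOne.sqrt A).toContinuousLinearMap.comp (WithLp.fstL 2 ℂ _ _)
  let P : PhaseSpace A →L[ℂ] H := WithLp.sndL 2 ℂ _ _
  let R : PhaseSpace A →L[ℂ] PhaseSpace A :=
    ((WithLp.prodContinuousLinearEquiv 2 ℂ (HOne A) H).symm :
      HOne A × H →L[ℂ] PhaseSpace A).comp
      ((J.toContinuousLinearMap.comp ((E.bdd a).comp S + (E.bdd b).comp P)).prod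
        ((E.bdd fun s => -1 * b s).comp S + (E.bdd g).comp P))
  have hR1 : ∀ y, (R y).fst = J (E.bdd a (HOne.sqrt A y.fst) + E.bdd b y.snd) := fun _ => rfl
  have hR2 : ∀ y, (R y).snd = E.bdd (fun s => -1 * b s) (HOne.sqrt A y.fst) + E.bdd g y.snd :=
    fun _ => rfl
  refine mem_resolventSet_of_graph R (fun y => ?_) fun x hx => ?_
  · rw [graph_generator hE hf]
    set X := HOne.sqrt A y.fst with hX
    have hyX : HOne.incl A y.fst = E.bdd ρ X := HOne.incl_eq_bdd hE hc hcσ _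
    constructor
    · change HOne.incl A (ξ • (R y).fst - y.fst) = (R y).snd
      rw [hR1, hR2, map_sub, map_smul, hincl, hyX, map_add, E.bdd_bdd ha hρ, E.bdd_bdd hb hρ,
        smul_add, ← E.bdd_const_mul (hρ.mul ha), ← E.bdd_const_mul (hρ.mul hb), add_sub_right_comm,
        ← E.bdd_sub (.mul (.const _) (hρ.mul ha)) hρ]
      congr 3 <;> ext s
      · simp only [ha', hb', hρ']
        have e1 := hp0 s
        have e2 := hq0 s
        field_simp
        rw [← hq2, hp]
        ring
      · simp only [hb', hρ', hg']
        have e1 := hp0 s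
        have e2 := hq0 s
        field_simp
    · change IsWeakSum A f (HOne.incl A (R y).fst) (R y).snd (-(ξ • (R y).snd - y.snd))
      -- Contributions of the two components of `y`: `√s a - f b = ξ b` and `√s b + f g = 1 - ξ g`.
      have w1 := isWeakSum_bdd hE hf (hρ.mul ha) hnb (k := fun s => ξ * b s) (.mul (.const _) hb)
        (fun s => by
          simp only [ha', hb', hρ']
          have e1 := hp0 s
          have e2 := hq0 s
          rw [hq2]
          field_simp
          ring) X
      have w2 := isWeakSum_bdd hE hf (hρ.mul hb) hg (k := fun s => 1 + -ξ * g s)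
        (.add (.const _) (.mul (.const _) hg))
        (fun s => by
          simp only [hb', hρ', hg']
          have e1 := hp0 s
          have e2 := hq0 s
          field_simp
          rw [hp]
          ring) y.snd
      convert w1.add w2 using 1
      · rw [hR1, hincl, map_add, E.bdd_bdd ha hρ, E.bdd_bdd hb hρ]
      · exact hR2 y
      · rw [hR2, E.bdd_add (.const 1) (.mul (.const _) hg), E.bdd_one, E.bdd_const_mul hg,
          E.bdd_const_mul hb, E.bdd_const_mul hb]
        simp only [smul_add, smul_neg, neg_smul, one_smul]
        abel
  · rw [graph_generator hE hf] at hx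
    obtain ⟨h1, h2⟩ := hx
    change HOne.incl A (ξ • x.fst) = x.snd at h1
    change IsWeakSum A f (HOne.incl A x.fst) x.snd (-(ξ • x.snd)) at h2
    rw [← h1, map_smul] at h2
    have h3 : HOne.incl A x.fst = 0 := h2.eq_zero_of_eigen hE hf hinv hp0
    have h4 : x.fst = 0 := HOne.incl_injective (by rw [h3, map_zero])
    have h5 : x.snd = 0 := by rw [← h1, h4, smul_zero, map_zero]
    exact WithLp.ofLp_injective 2 (Prod.ext h4 h5)

/-- If `ξ` is in the resolvent set of the generator then `|ξ + f| ≤ C |ξ² + ξ f + s|` on `σ(A)`. -/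
theorem exists_le_of_mem_resolventSet_generator (hE : IsCalculusMeasure A E) {c : ℝ} (hc : 0 < c)
    (hcσ : ∀ s : realSpectrum A, c ≤ s) (hf : Continuous f) {ξ : ℂ}
    (hξ : ξ ∈ resolventSet (generator A f)) :
    ∃ ε > 0, ∀ s, ε * ‖ξ + f s‖ ≤ ‖ξ ^ 2 + ξ * f s + (s : ℝ)‖ := by
  obtain ⟨C, hC, hbound⟩ := exists_bound_of_mem_resolventSet hξ
  refine ⟨(2 * C)⁻¹, by positivity, fun s₀ => not_lt.1 fun hs₀ => ?_⟩
  obtain ⟨J, hJ⟩ := HOne.exists_isometry hE hc hcσ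
  have hpos : ∀ s : realSpectrum A, 0 < (s : ℝ) := fun s => hc.trans_le (hcσ s)
  -- Chosen so that a relative residual `ε` would give `‖x‖ ≤ ‖x‖/2` in the resolvent bound.
  set ε : ℝ := (2 * C)⁻¹ with hε
  have hεpos : 0 < ε := by positivity
  have hs₀' : 0 < ‖ξ + f s₀‖ := pos_of_mul_pos_right ((norm_nonneg _).trans_lt hs₀) hεpos.le
  set δ : ℝ := ‖ξ + f s₀‖ / 2 with hδ
  have hδpos : 0 < δ := by positivity
  set M : ℝ := (s₀ : ℝ) + 1 with hM
  have hMpos : 0 < M := by have := hpos s₀; positivity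
  -- The last two conditions keep `1/(ξ + f)` and `√s` bounded on `ω`, so that all multipliers below
  -- are bounded.
  let ω : Set (realSpectrum A) := {s | ‖ξ ^ 2 + ξ * f s + (s : ℝ)‖ < ε * ‖ξ + f s‖} ∩
    ({s | δ < ‖ξ + f s‖} ∩ {s | (s : ℝ) < M})
  have hω : IsOpen ω :=
    (isOpen_lt (by fun_prop) (by fun_prop)).inter
      ((isOpen_lt (by fun_prop) (by fun_prop)).inter (isOpen_lt (by fun_prop) (by fun_prop)))
  obtain ⟨U, hU0, hU⟩ := hE.isSpectralMeasureOf.exists_proj_eq_self hω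
    (s₀ := s₀) ⟨hs₀, half_lt_self hs₀', lt_add_one (s₀ : ℝ)⟩
  have hωm := hω.measurableSet
  set ι : realSpectrum A → ℂ := ω.indicator fun _ => (1 : ℂ) with hι
  have hιb : SpectralMeasure.IsBddMeasurable ι := .indicator hωm
  have hιU : E.bdd ι U = U := by rw [hι, E.bdd_indicator hωm, hU]
  have hfm := measurable_ofReal_comp hf
  set q : realSpectrum A → ℂ := fun s => (ξ + f s)⁻¹ * ι s with hq
  have hqb : SpectralMeasure.IsBddMeasurable q := by
    refine .of_le (C := δ⁻¹) (((measurable_const.add hfm).inv).mul hιb.1) fun s => ?_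
    by_cases hs : s ∈ ω
    · simp only [hq, hι, Set.indicator_of_mem hs, mul_one, norm_inv]
      exact inv_anti₀ hδpos hs.2.1.le
    · simp only [hq, hι, Set.indicator_of_notMem hs, mul_zero, norm_zero]
      positivity
  have hρ := HOne.isBddMeasurable_inv_sqrt hc hcσ
  have hsι : SpectralMeasure.IsBddMeasurable fun s : realSpectrum A => ((√(s : ℝ) : ℝ) : ℂ) * ι s := by
    refine .of_le (C := √M) ((by fun_prop : Measurable fun s : realSpectrum A =>
      ((√(s : ℝ) : ℝ) : ℂ)).mul hιb.1) fun s => ?_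
    by_cases hs : s ∈ ω
    · simp only [hι, Set.indicator_of_mem hs, mul_one]
      rw [Complex.norm_real, Real.norm_of_nonneg (Real.sqrt_nonneg _)]
      exact Real.sqrt_le_sqrt hs.2.2.le
    · simp only [hι, Set.indicator_of_notMem hs, mul_zero, norm_zero]
      positivity
  set r : realSpectrum A → ℂ := fun s => ((√(s : ℝ) : ℝ) : ℂ) * ι s with hr
  set ρ : realSpectrum A → ℂ := fun s => ((√(s : ℝ) : ℝ) : ℂ)⁻¹ with hρ'
  have hιι : ∀ s, ι s * ι s = ι s := fun s => by by_cases hs : s ∈ ω <;> simp [hι, hs]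
  have hq0 : ∀ s : realSpectrum A, ((√(s : ℝ) : ℝ) : ℂ) ≠ 0 := fun s =>
    HOne.ofReal_sqrt_ne_zero (hpos s)
  have hq2 : ∀ s : realSpectrum A, ((s : ℝ) : ℂ) = ((√(s : ℝ) : ℝ) : ℂ) ^ 2 := fun s => by
    rw [← Complex.ofReal_pow, Real.sq_sqrt (hpos s).le]
  have hqι : ∀ s, (ξ + f s) * q s = ι s := by
    intro s
    by_cases hs : s ∈ ω
    · simp only [hq, hι, Set.indicator_of_mem hs, mul_one]
      exact mul_inv_cancel₀ (norm_pos_iff.1 (hδpos.trans hs.2.1))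
    · simp only [hq, hι, Set.indicator_of_notMem hs, mul_zero]
  have hqq : ∀ s, q s * ι s = q s := fun s => by simp only [hq]; rw [mul_assoc, hιι]
  have hrq : SpectralMeasure.IsBddMeasurable fun s => -1 * (r s * q s) :=
    .mul (.const _) (hsι.mul hqb)
  have hrrq : SpectralMeasure.IsBddMeasurable fun s => -1 * (r s * (r s * q s)) :=
    .mul (.const _) (hsι.mul (hsι.mul hqb))
  have hincl : ∀ w, HOne.incl A (J w) = E.bdd ρ w := fun w => by
    rw [HOne.incl_eq_bdd hE hc hcσ, hJ]
  -- `v = -√s (ξ + f)⁻¹ U` solves the second row of `(ξ - M)(U, v) = (·, 0)` exactly, and `V = √s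
  -- v`; the first row leaves the residual `p (ξ + f)⁻¹ U`, of norm at most `ε ‖U‖` by the choice of
  -- `ω`.
  set v : H := E.bdd (fun s => -1 * (r s * q s)) U with hv
  set V : H := E.bdd (fun s => -1 * (r s * (r s * q s))) U with hV
  have hgraph : ((WithLp.toLp 2 (J U, v), WithLp.toLp 2 (J V, ξ • v)) :
      PhaseSpace A × PhaseSpace A) ∈ (generator A f).graph := by
    rw [graph_generator hE hf]
    constructor
    · change HOne.incl A (J V) = v
      rw [hincl, hV, E.bdd_bdd hrrq hρ, hv]
      congr 2
      ext s
      simp only [hr, hρ']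
      have e2 := hq0 s
      field_simp
      linear_combination (-ι s) * hqq s
    · change IsWeakSum A f (HOne.incl A (J U)) v (-(ξ • v))
      have w := isWeakSum_bdd hE hf (hρ.mul hιb) hrq (k := fun s => ξ * (r s * q s))
        (.mul (.const _) (hsι.mul hqb)) (fun s => by
          simp only [hr, hρ']
          have e2 := hq0 s
          rw [hq2]
          field_simp
          linear_combination (-ι s) * hqι s - hιι s) U
      convert w using 1
      · rw [hincl, ← E.bdd_bdd hιb hρ, hιU]
      · rw [E.bdd_const_mul (hsι.mul hqb), hv, E.bdd_const_mul (hsι.mul hqb)]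
        simp
  have hres : ‖ξ • U - V‖ ≤ ε * ‖U‖ := by
    have e : ξ • U - V = E.bdd (fun s => ξ * ι s - -1 * (r s * (r s * q s))) U := by
      rw [E.bdd_sub (.mul (.const _) hιb) hrrq, E.bdd_const_mul hιb, hιU]
    rw [e]
    refine E.norm_bdd_le ((hιb.1.const_mul ξ).sub hrrq.1) hεpos.le (fun s => ?_) U
    rw [Pi.sub_apply]
    by_cases hs : s ∈ ω
    · have e1 := norm_pos_iff.1 (hδpos.trans hs.2.1)
      have e3 : ξ * ι s - -1 * (r s * (r s * q s)) =
          (ξ ^ 2 + ξ * f s + (s : ℝ)) / (ξ + f s) := by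
        simp only [hr, hq, hι, Set.indicator_of_mem hs, mul_one]
        rw [hq2]
        field_simp
        ring
      rw [e3, norm_div, div_le_iff₀ (norm_pos_iff.2 e1)]
      exact hs.1.le
    · simp only [hr, hq, hι, Set.indicator_of_notMem hs, mul_zero, sub_zero, norm_zero]
      exact hεpos.le
  have h1 := hbound _ _ hgraph
  have h2 : ξ • (WithLp.toLp 2 (J U, v) : PhaseSpace A) - WithLp.toLp 2 (J V, ξ • v) =
      WithLp.toLp 2 (J (ξ • U - V), 0) := by
    refine WithLp.ofLp_injective 2 (Prod.ext ?_ ?_)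
    · change ξ • J U - J V = J (ξ • U - V)
      rw [map_sub, map_smul]
    · exact sub_self _
  rw [h2, WithLp.norm_toLp_fst, J.norm_map] at h1
  have h3 : ‖U‖ ≤ ‖(WithLp.toLp 2 (J U, v) : PhaseSpace A)‖ := by
    rw [← J.norm_map U]
    exact WithLp.norm_fst_le _ (WithLp.toLp 2 (J U, v) : PhaseSpace A)
  have h4 : 0 < ‖U‖ := norm_pos_iff.2 hU0
  have h5 : C * ‖ξ • U - V‖ ≤ C * (ε * ‖U‖) := by gcongr
  have h6 : C * (ε * ‖U‖) = ‖U‖ / 2 := by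
    rw [hε]
    field_simp
  linarith

end GeneratorSpectrum

end

/-- The spectrum of the generator away from zero. -/
theorem spectrum_generator_sdiff_zero {H : Type*} [NormedAddCommGroup H] [InnerProductSpace ℂ H]
    [CompleteSpace H] {A : H →ₗ.[ℂ] H} (hA : IsSelfAdjoint A) (hpos : IsStrictlyPositive A)
    {f : realSpectrum A → ℝ} (hf : Continuous f) (hf0 : ∀ s, 0 ≤ f s) :
    spectrum (generator A f) \ {0} =
      (⋃ s : realSpectrum A, {xiPlus (f s) s, xiMinus (f s) s}) ∪
      ⋃ l ∈ limitSet A f, {-1 / (l : ℂ)} := by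
  obtain ⟨E, hE⟩ := exists_isCalculusMeasure hA hpos
  obtain ⟨c, hc, hcσ⟩ := hE.isSpectralMeasureOf.exists_lower_bound hpos
  have hspos : ∀ s : realSpectrum A, 0 < (s : ℝ) := fun s => hc.trans_le (hcσ s)
  -- The negated resolvent criterion, valid also at `ξ = 0`; from here on the argument concerns only
  -- scalar functions on `σ(A)`.
  have hspec : ∀ ξ, ξ ∈ spectrum (generator A f) ↔
      ∀ ε > 0, ∃ s : realSpectrum A, ‖ξ ^ 2 + ξ * f s + (s : ℝ)‖ < ε * ‖ξ + f s‖ := by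
    intro ξ
    rw [spectrum, Set.mem_compl_iff, not_iff_comm]
    push Not
    exact ⟨fun ⟨ε, hε, h⟩ => mem_resolventSet_generator hE hc hcσ hf hε h,
      exists_le_of_mem_resolventSet_generator hE hc hcσ hf⟩
  ext ξ
  simp only [Set.mem_sdiff, Set.mem_singleton_iff, Set.mem_union, Set.mem_iUnion, Set.mem_insert_iff,
    hspec, eq_xiPlus_or_eq_xiMinus_iff (hspos _) (hf0 _), exists_prop]
  constructor
  · rintro ⟨h, hξ⟩
    obtain h | ⟨l, hl, hs, h⟩ := root_or_limit_of_forall_exists_lt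
      hE.isSpectralMeasureOf.isClosed_realSpectrum hc hcσ hf hf0 hξ h
    · exact .inl h
    · exact .inr ⟨l, ⟨hl, hs⟩, h⟩
  · rintro (⟨s, hs⟩ | ⟨l, ⟨hl, s, hs, hfs⟩, h⟩)
    · refine ⟨fun ε hε => ⟨s, exists_lt_of_root (hspos s).ne' hs hε⟩, ?_⟩
      rintro rfl
      refine (hspos s).ne' ?_
      have : ((s : ℝ) : ℂ) = 0 := by simpa using hs
      exact_mod_cast this
    · refine ⟨fun ε hε => exists_lt_of_limit hl hs hfs h hε, ?_⟩
      rw [h]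
      exact div_ne_zero (by norm_num) (Complex.ofReal_ne_zero.2 hl.ne')

end DampedEvolution

end

theorem mainTheorem6 {H : Type*} [NormedAddCommGroup H] [InnerProductSpace ℂ H] [CompleteSpace H]
    [TopologicalSpace.SeparableSpace H]
    (A : H →ₗ.[ℂ] H) (hA : IsSelfAdjoint A) (hpos : DampedEvolution.IsStrictlyPositive A)
    (f : DampedEvolution.realSpectrum A → ℝ) (hf : Continuous f) (hf0 : ∀ s, 0 ≤ f s) :
    DampedEvolution.spectrum (DampedEvolution.generator A f) \ {0} =
      (⋃ s : DampedEvolution.realSpectrum A,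
        {DampedEvolution.xiPlus (f s) s, DampedEvolution.xiMinus (f s) s}) ∪
      ⋃ l ∈ DampedEvolution.limitSet A f, {-1 / (l : ℂ)} :=
  DampedEvolution.spectrum_generator_sdiff_zero hA hpos hf hf0
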